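/- A tetrahedral mesh in $\mathbb{R}^3$ is a finite geometric simplicial complex in $\mathbb{R}^3$ in which every simplex is a face of a tetrahedron. It is completely well-centered if, for $k=1,2,3$, every $k$-dimensional simplex of the mesh contains its circumcenter in its relative interior. A triangulation of $S^2$ is a finite abstract simplicial complex whose geometric realization is homeomorphic to $S^2$. The link of a vertex $u$ consists of all faces, not containing $u$, of simplices that contain $u$. Proposition. There are infinitely many pairwise non-isomorphic triangulations of $S^2$ that are isomorphic to the link of a vertex in a completely well-centered tetrahedral mesh in $\mathbb{R}^3$. More precisely, for every integer $k\ge 4$ let $N=(0,0,1)$, $S=(0,0,-1)$, \[ t_i=\Bigl(0.936\cos\tfrac{2i\pi}{k},\,0.936\sin\tfrac{2i\pi}{k},\,0.352\Bigr),\qquad b_i=\Bigl(0.936\cos\tfrac{(2i+1)\pi}{k},\,0.936\sin\tfrac{(2i+1)\pi}{k},\,-0.352\Bigr), \] with indices $i$ taken modulo $k$; these points lie on the unit sphere. Consider the $4k$ triangles $[N\,t_i\,t_{i+1}]$, $[S\,b_i\,b_{i+1}]$, $[t_i\,t_{i+1}\,b_i]$, $[b_i\,b_{i+1}\,t_{i+1}]$.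 The tetrahedra obtained by coning these triangles to the origin, together with all their faces, form a completely well-centered tetrahedral mesh in $\mathbb{R}^3$. The link of the origin in this mesh consists of the $4k$ triangles and their faces, and it is a triangulation of $S^2$. -/

import Mathlib

namespace WellCentered

/-- Euclidean three-space. -/
abbrev E3 : Type := EuclideanSpace ℝ (Fin 3)

section Abstract

variable {α β γ : Type*}

/-- The vertices of an abstract simplicial complex. -/
def vertexSet (K : PreAbstractSimplicialComplex α) : Set α :=
  {v | {v} ∈ K.faces}

/-- Two abstract simplicial complexes are isomorphic if there is a bijection between their
vertex sets under which a set of vertices spans a simplex exactly if its image does. -/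
def Isomorphic (K : PreAbstractSimplicialComplex α) (L : PreAbstractSimplicialComplex β) : Prop :=
  ∃ e : vertexSet K ≃ vertexSet L, ∀ s : Finset (vertexSet K),
    s.map (Function.Embedding.subtype _) ∈ K.faces ↔
      (s.map e.toEmbedding).map (Function.Embedding.subtype _) ∈ L.faces

theorem Isomorphic.refl (K : PreAbstractSimplicialComplex α) : Isomorphic K K :=
  ⟨Equiv.refl _, fun s => by simp⟩

theorem Isomorphic.symm {K : PreAbstractSimplicialComplex α}
    {L : PreAbstractSimplicialComplex β} (h : Isomorphic K L) : Isomorphic L K := by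
  obtain ⟨e, he⟩ := h
  refine ⟨e.symm, fun s => ?_⟩
  rw [he (s.map e.symm.toEmbedding)]
  have h2 : (s.map e.symm.toEmbedding).map e.toEmbedding = s := by
    ext x; simp
  rw [h2]

theorem Isomorphic.trans {K : PreAbstractSimplicialComplex α}
    {L : PreAbstractSimplicialComplex β} {M : PreAbstractSimplicialComplex γ}
    (h : Isomorphic K L) (h' : Isomorphic L M) : Isomorphic K M := by
  obtain ⟨e, he⟩ := h
  obtain ⟨f, hf⟩ := h'
  refine ⟨e.trans f, fun s => ?_⟩
  rw [he s, hf (s.map e.toEmbedding)]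
  have h2 : (s.map e.toEmbedding).map f.toEmbedding = s.map (e.trans f).toEmbedding := by
    rw [Finset.map_map]; rfl
  rw [h2]

/-- Isomorphism as an equivalence relation on the abstract complexes with vertices in `ℕ`.
Every finite complex is isomorphic to one of these. -/
def isoSetoid : Setoid (PreAbstractSimplicialComplex ℕ) where
  r K L := Isomorphic K L
  iseqv := ⟨Isomorphic.refl, Isomorphic.symm, Isomorphic.trans⟩

/-- The geometric realization of an abstract simplicial complex, in barycentric coordinates.
For a finite complex, the only case in which it is used, the subspace topology from `α → ℝ`
is the usual topology of the realization. -/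
def realization (K : PreAbstractSimplicialComplex α) : Set (α → ℝ) :=
  {x | (∀ v, 0 ≤ x v) ∧ ∃ s ∈ K.faces, (∀ v, v ∉ s → x v = 0) ∧ ∑ v ∈ s, x v = 1}

/-- A triangulation of the 2-sphere: a finite simplicial complex whose geometric realization
is homeomorphic to the unit sphere of three-space. -/
def IsSphereTriangulation (K : PreAbstractSimplicialComplex α) : Prop :=
  K.faces.Finite ∧ Nonempty (realization K ≃ₜ Metric.sphere (0 : E3) 1)

/-- The link of `u`: the simplices of the closed star of `u` (that is, the faces of the
simplices incident to `u`) that do not have `u` as a vertex. -/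
def link (K : PreAbstractSimplicialComplex α) (u : α) : PreAbstractSimplicialComplex α where
  faces := {s | s ∈ K.faces ∧ u ∉ s ∧ ∃ t ∈ K.faces, u ∈ t ∧ s ⊆ t}
  isRelLowerSet_faces := by
    rintro s ⟨hs, hus, t, ht, hut, hst⟩
    refine ⟨(K.isRelLowerSet_faces hs).1, fun r hrs hr => ?_⟩
    exact ⟨(K.isRelLowerSet_faces hs).2 hrs hr, fun h => hus (hrs h), t, ht, hut, hrs.trans hst⟩

/-- The simplices spanned by the nonempty subsets of the members of `F`. -/
def generatedFaces (F : Set (Finset α)) : Set (Finset α) :=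
  {s | s.Nonempty ∧ ∃ t ∈ F, s ⊆ t}

end Abstract

section Mesh

/-- A tetrahedral mesh in three-space: a finite simplicial complex in which every simplex is
a face of a tetrahedron. -/
def IsTetrahedralMesh (M : Geometry.SimplicialComplex ℝ E3) : Prop :=
  M.faces.Finite ∧ ∀ s ∈ M.faces, ∃ t ∈ M.faces, s ⊆ t ∧ t.card = 4

/-- Every `k`-dimensional simplex of `M` has its circumcenter in its (relative) interior. -/
def IsWellCentered (k : ℕ) (M : Geometry.SimplicialComplex ℝ E3) : Prop :=
  ∀ σ : Affine.Simplex ℝ E3 k, (∃ s ∈ M.faces, (s : Set E3) = Set.range σ.points) →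
    σ.circumcenter ∈ σ.interior

/-- `M` is `k`-well-centered for `k = 1, 2, 3`. -/
def IsCompletelyWellCentered (M : Geometry.SimplicialComplex ℝ E3) : Prop :=
  ∀ k : ℕ, 1 ≤ k → k ≤ 3 → IsWellCentered k M

/-- `T` is isomorphic to the link of a vertex of a completely well-centered tetrahedral mesh. -/
def AppearsAsLink {α : Type*} (T : PreAbstractSimplicialComplex α) : Prop :=
  ∃ M : Geometry.SimplicialComplex ℝ E3, IsTetrahedralMesh M ∧ IsCompletelyWellCentered M ∧
    ∃ u ∈ M.vertices, Isomorphic T (link M.toPreAbstractSimplicialComplex u)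

end Mesh

noncomputable section Polygons

/-- The north pole. -/
def north : E3 := !₂[0, 0, 1]

/-- The south pole. -/
def south : E3 := !₂[0, 0, -1]

/-- The vertices of the upper regular `k`-gon; the index `i` counts modulo `k`. -/
def upper (k i : ℕ) : E3 :=
  !₂[0.936 * Real.cos (2 * i * Real.pi / k), 0.936 * Real.sin (2 * i * Real.pi / k), 0.352]

/-- The vertices of the lower regular `k`-gon, out of phase with the upper one; the index `i`
counts modulo `k`. -/
def lower (k i : ℕ) : E3 :=
  !₂[0.936 * Real.cos ((2 * i + 1) * Real.pi / k), 0.936 * Real.sin ((2 * i + 1) * Real.pi / k),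
    -0.352]

open Classical in
/-- The `4 * k` triangles: `k` at each pole, and `2 * k` between the two polygons. -/
def triangles (k : ℕ) : Set (Finset E3) :=
  {t | ∃ i : ℕ, t = {north, upper k i, upper k (i + 1)} ∨ t = {south, lower k i, lower k (i + 1)} ∨
    t = {upper k i, upper k (i + 1), lower k i} ∨ t = {lower k i, lower k (i + 1), upper k (i + 1)}}

open Classical in
/-- The tetrahedra obtained by coning the triangles to the origin. -/
def tetrahedra (k : ℕ) : Set (Finset E3) :=
  {s | ∃ t ∈ triangles k, s = insert 0 t}

end Polygons

end WellCentered

/-! The `4 * k` triangles are the facets of a convex polytope inscribed in the unit sphere, an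
antiprism with a pyramid on each `k`-gon. Each facet plane is `l = 1` for a linear functional `l`
that is smaller than 1 at all other vertices (`exists_support_cap`, `exists_support_band`).
Comparing these functionals shows that nonnegative combinations over facets are unique and that the
cones over the facets cover space (`eq_of_sum_smul_eq`, `exists_sum_smul_eq`). Uniqueness makes the
tetrahedra at the origin meet in common faces. Together with covering it makes radial projection
from the link to the sphere a continuous bijection, and compactness makes that a homeomorphism.

Well-centeredness depends on inner products only. All triangles are isosceles with unit vertices, so
two numbers describe each: `p` along the legs and `q` along the base. The circumcenters are explicit
combinations of the vertices, and their coefficients are positive under the inequalities of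
`IsCenteredTriple`. For both kinds of triangle, `p` and `q` are polynomials in `s = cos (π / k)`,
and the inequalities hold for `√2 / 2 ≤ s < 1`, that is, for `4 ≤ k`. For height `h` and `k = 4` a
cap triangle has `p = h`, `q = h ^ 2`, so `(1 - 2 * p) ^ 2 < q` asks for `1 / 3 < h < 1`. The choice
`h = 0.352 = 44 / 125` satisfies this, and the radius `0.936 = 117 / 125` is rational.

Infinitely many types arise because the number of vertices is an isomorphism invariant and is at
least `2 * k`. -/

namespace WellCentered

/-! ### Cones over the facets of a convex polytope -/

section Fan

/-- A finite set of triples of vectors that span the maximal cones of a complete simplicial fan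
in three-space, such that the triangles spanned by the triples are the facets of a convex
polytope. -/
structure IsPolytopalFan (T : Set (Finset E3)) : Prop where
  finite : T.Finite
  nonempty : T.Nonempty
  card_eq : ∀ t ∈ T, t.card = 3
  linearIndepOn : ∀ t ∈ T, LinearIndepOn ℝ id (t : Set E3)
  exists_support : ∀ t ∈ T, ∃ l : E3 →ₗ[ℝ] ℝ, ∀ t' ∈ T, ∀ v ∈ t',
    (v ∈ t → l v = 1) ∧ (v ∉ t → l v < 1)
  exists_adjacent : ∀ t ∈ T, ∀ v ∈ t, ∃ t' ∈ T, v ∉ t' ∧ ∀ w ∈ t, w ≠ v → w ∈ t'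

namespace IsPolytopalFan

variable {T : Set (Finset E3)} {t t' : Finset E3} {x y : E3 → ℝ}

/-- Apply the support functional of `t` to both sides: it is 1 on `t` and at most 1 on `t'`.
Equality leaves no weight where it is smaller than 1. -/
theorem sum_le_sum_of_sum_smul_eq (h : IsPolytopalFan T) (ht : t ∈ T) (ht' : t' ∈ T)
    (hy : ∀ v, 0 ≤ y v) (hxy : ∑ v ∈ t, x v • v = ∑ v ∈ t', y v • v) :
    ∑ v ∈ t, x v ≤ ∑ v ∈ t', y v ∧
      (∑ v ∈ t, x v = ∑ v ∈ t', y v → ∀ v ∈ t', v ∉ t → y v = 0) := by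
  obtain ⟨l, hl⟩ := h.exists_support t ht
  have h1 : ∑ v ∈ t, x v = ∑ v ∈ t', y v * l v := by
    have h2 := congrArg l hxy
    simp only [map_sum, map_smul, smul_eq_mul] at h2
    rw [← h2]
    exact Finset.sum_congr rfl fun v hv => by rw [(hl t ht v hv).1 hv, mul_one]
  have h3 : ∀ v ∈ t', y v * l v ≤ y v := fun v hv => by
    refine mul_le_of_le_one_right (hy v) ?_
    by_cases hvt : v ∈ t
    · exact ((hl t' ht' v hv).1 hvt).le
    · exact ((hl t' ht' v hv).2 hvt).le
  rw [h1]
  refine ⟨Finset.sum_le_sum h3, fun h4 v hv hvt => ?_⟩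
  have h5 := (Finset.sum_eq_sum_iff_of_le h3).1 h4 v hv
  have h6 := (hl t' ht' v hv).2 hvt
  by_contra h7
  exact h6.ne (mul_left_cancel₀ h7 (by rw [h5, mul_one]))

/-- A vector is a nonnegative combination of the vectors of a cone in at most one way. -/
theorem eq_of_sum_smul_eq (h : IsPolytopalFan T) (ht : t ∈ T) (ht' : t' ∈ T)
    (hx : ∀ v, 0 ≤ x v) (hy : ∀ v, 0 ≤ y v) (hxt : ∀ v ∉ t, x v = 0) (hyt : ∀ v ∉ t', y v = 0)
    (hxy : ∑ v ∈ t, x v • v = ∑ v ∈ t', y v • v) : x = y := by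
  classical
  -- Used in both directions, the comparison makes the two sums equal. So `y` is supported on `t` as
  -- well, and linear independence of `t` applies.
  have h1 := h.sum_le_sum_of_sum_smul_eq ht ht' hy hxy
  have h2 := h.sum_le_sum_of_sum_smul_eq ht' ht hx hxy.symm
  have h3 := h1.2 (le_antisymm h1.1 h2.1)
  have h4 : ∀ v ∉ t, y v = 0 := fun v hv => by
    by_cases hvt : v ∈ t'
    · exact h3 v hvt hv
    · exact hyt v hvt
  have h5 : ∑ v ∈ t', y v • v = ∑ v ∈ t, y v • v := by
    rw [Finset.sum_subset (Finset.subset_union_left (s₁ := t') (s₂ := t)),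
      Finset.sum_subset (Finset.subset_union_right (s₁ := t') (s₂ := t))]
    · intro v _ hv; rw [h4 v hv, zero_smul]
    · intro v _ hv; rw [hyt v hv, zero_smul]
  funext v
  by_cases hv : v ∈ t
  · have h6 : ∑ v ∈ t, (x v - y v) • id v = 0 := by
      simp only [id, sub_smul, Finset.sum_sub_distrib]
      rw [hxy, h5, sub_self]
    exact sub_eq_zero.1 (linearIndepOn_finset_iff.1 (h.linearIndepOn t ht) _ h6 v hv)
  · rw [hxt v hv, h4 v hv]

theorem exists_sum_smul_eq_real (h : IsPolytopalFan T) (ht : t ∈ T) (p : E3) :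
    ∃ x : E3 → ℝ, (∀ v ∉ t, x v = 0) ∧ ∑ v ∈ t, x v • v = p := by
  classical
  have h1 : Submodule.span ℝ (t : Set E3) = ⊤ := by
    have h2 := (h.linearIndepOn t ht).linearIndependent.span_eq_top_of_card_eq_finrank'
      (by simp [h.card_eq t ht])
    simpa using h2
  have h2 : p ∈ Submodule.span ℝ (t : Set E3) := h1 ▸ Submodule.mem_top
  obtain ⟨f, hf, h3⟩ := Submodule.mem_span_finset.1 h2
  exact ⟨f, fun v hv => by_contra fun h => hv (hf h), h3⟩

/-- The cones of a polytopal fan cover the space. -/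
theorem exists_sum_smul_eq (h : IsPolytopalFan T) (p : E3) :
    ∃ t ∈ T, ∃ x : E3 → ℝ, (∀ v, 0 ≤ x v) ∧ (∀ v ∉ t, x v = 0) ∧ ∑ v ∈ t, x v • v = p := by
  choose! l hl using h.exists_support
  -- The ray through `p` leaves the polytope at a facet whose functional is largest at `p`.
  obtain ⟨t, ht, hmax⟩ := h.finite.exists_maximalFor (fun t => l t p) T h.nonempty
  obtain ⟨x, hx, hxp⟩ := h.exists_sum_smul_eq_real ht p
  refine ⟨t, ht, x, fun v => ?_, hx, hxp⟩
  by_contra! hv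
  have hvt : v ∈ t := by_contra fun h => hv.ne (hx v h)
  -- Across the edge opposite `v`, the functional keeps its values on that edge and drops at `v`. A
  -- negative coefficient at `v` would then increase the value at `p`.
  obtain ⟨t', ht', hvt', hw⟩ := h.exists_adjacent t ht v hvt
  have h1 : ∀ t'', l t'' p = ∑ v ∈ t, x v * l t'' v := fun t'' => by
    rw [← hxp]; simp
  have h2 : l t p < l t' p := by
    rw [h1, h1]
    refine Finset.sum_lt_sum (fun w hwt => ?_) ⟨v, hvt, ?_⟩
    · rw [(hl t ht t ht w hwt).1 hwt]
      by_cases hwv : w = v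
      · subst hwv
        exact mul_le_mul_of_nonpos_left ((hl t' ht' t ht w hwt).2 hvt').le hv.le
      · rw [(hl t' ht' t ht w hwt).1 (hw w hwt hwv)]
    · rw [(hl t ht t ht v hvt).1 hvt]
      exact mul_lt_mul_of_neg_left ((hl t' ht' t ht v hvt).2 hvt') hv
  exact absurd (hmax ht' h2.le) (not_le.2 h2)

theorem ne_zero (h : IsPolytopalFan T) (ht : t ∈ T) {v : E3} (hv : v ∈ t) : v ≠ 0 :=
  (h.linearIndepOn t ht).ne_zero hv

theorem zero_notMem (h : IsPolytopalFan T) (ht : t ∈ T) : (0 : E3) ∉ t :=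
  fun hv => h.ne_zero ht hv rfl

open Classical in
theorem affineIndependent_insert (h : IsPolytopalFan T) (ht : t ∈ T) :
    AffineIndependent ℝ ((↑) : (insert 0 (t : Set E3) : Set E3) → E3) := by
  have h1 := (linearIndependent_set_iff_affineIndependent_vadd_union_singleton ℝ
    (fun v hv => h.ne_zero ht hv) (0 : E3)).1 (h.linearIndepOn t ht).linearIndependent
  have h2 : ({0} ∪ (fun v : E3 => v +ᵥ (0 : E3)) '' (t : Set E3) : Set E3) = insert 0 (t : Set E3) := by
    ext; simp
  rwa [h2] at h1

/-- The weights of a convex combination, extended by zero. -/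
theorem exists_weights_of_mem_convexHull {s : Finset E3} {p : E3}
    (hp : p ∈ convexHull ℝ (s : Set E3)) :
    ∃ w : E3 → ℝ, (∀ v, 0 ≤ w v) ∧ (∀ v ∉ s, w v = 0) ∧ ∑ v ∈ s, w v = 1 ∧
      ∑ v ∈ s, w v • v = p := by
  classical
  obtain ⟨w, hw, hw1, hwp⟩ := Finset.mem_convexHull'.1 hp
  refine ⟨fun v => if v ∈ s then w v else 0, fun v => ?_, fun v hv => if_neg hv, ?_, ?_⟩
  · dsimp only; split_ifs with hv
    exacts [hw v hv, le_rfl]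
  · rw [← hw1]; exact Finset.sum_congr rfl fun v hv => if_pos hv
  · rw [← hwp]; exact Finset.sum_congr rfl fun v hv => by simp only [if_pos hv]

open Classical in
theorem convexHull_inter_subset (h : IsPolytopalFan T) (ht : t ∈ T) (ht' : t' ∈ T)
    {s s' : Finset E3} (hs : s ⊆ insert 0 t) (hs' : s' ⊆ insert 0 t') :
    convexHull ℝ (s : Set E3) ∩ convexHull ℝ (s' : Set E3) ⊆
      convexHull ℝ ((s : Set E3) ∩ s') := by
  rintro p ⟨hp, hp'⟩
  obtain ⟨w, hw, hws, hw1, hwp⟩ := exists_weights_of_mem_convexHull hp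
  obtain ⟨w', hw', hws', hw1', hwp'⟩ := exists_weights_of_mem_convexHull hp'
  -- Deleting the weight of the origin turns a convex combination into a conic one over `t` with the
  -- same value. The deleted weight is recovered from the total 1.
  have key : ∀ {t s : Finset E3} {w : E3 → ℝ} (_ : t ∈ T) (_ : s ⊆ insert 0 t)
      (_ : ∀ v ∉ s, w v = 0) (_ : ∑ v ∈ s, w v = 1),
      (∀ v ∉ t, Function.update w 0 0 v = 0) ∧
      ∑ v ∈ t, Function.update w 0 0 v • v = ∑ v ∈ s, w v • v ∧
      w 0 = 1 - ∑ v ∈ t, Function.update w 0 0 v := by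
    intro t s w ht hs hws hw1
    have h0 := h.zero_notMem ht
    have h1 : ∀ v ∈ t, Function.update w 0 0 v = w v := fun v hv =>
      Function.update_of_ne (h.ne_zero ht hv) _ _
    refine ⟨fun v hv => ?_, ?_, ?_⟩
    · by_cases h2 : v = 0
      · rw [h2, Function.update_self]
      · rw [Function.update_of_ne h2]
        exact hws v fun h3 => (Finset.mem_insert.1 (hs h3)).elim h2 hv
    · rw [Finset.sum_subset hs (fun v _ hv => by rw [hws v hv, zero_smul]),
        Finset.sum_insert h0, smul_zero, zero_add]
      exact Finset.sum_congr rfl fun v hv => by rw [h1 v hv]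
    · rw [← hw1, Finset.sum_subset hs (fun v _ hv => hws v hv), Finset.sum_insert h0,
        Finset.sum_congr rfl h1]
      ring
  obtain ⟨h1, h2, h3⟩ := key ht hs hws hw1
  obtain ⟨h1', h2', h3'⟩ := key ht' hs' hws' hw1'
  have hnn : ∀ {w : E3 → ℝ}, (∀ v, 0 ≤ w v) → ∀ v, 0 ≤ Function.update w 0 0 v := by
    intro w hw v
    by_cases h2 : v = 0
    · rw [h2, Function.update_self]
    · rw [Function.update_of_ne h2]; exact hw v
  have h4 := h.eq_of_sum_smul_eq ht ht' (hnn hw) (hnn hw') h1 h1'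
    (by rw [h2, h2', hwp, hwp'])
  have h5 : ∑ v ∈ t, Function.update w 0 0 v = ∑ v ∈ t', Function.update w' 0 0 v := by
    rw [Finset.sum_subset (Finset.subset_union_left (s₁ := t) (s₂ := t')) (fun v _ hv => h1 v hv),
      Finset.sum_subset (Finset.subset_union_right (s₁ := t) (s₂ := t')) (fun v _ hv => h1' v hv),
      h4]
  have h6 : w = w' := by
    funext v
    by_cases hv : v = 0
    · rw [hv, h3, h3', h5]
    · have := congrFun h4 v
      rwa [Function.update_of_ne hv, Function.update_of_ne hv] at this
  subst h6
  have h7 : ∀ v ∈ s, v ∉ s ∩ s' → w v = 0 := fun v hv hv' =>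
    hws' v fun h => hv' (Finset.mem_inter.2 ⟨hv, h⟩)
  rw [← Finset.coe_inter]
  refine Finset.mem_convexHull'.2 ⟨w, fun v _ => hw v, ?_, ?_⟩
  · rw [← hw1]; exact Finset.sum_subset Finset.inter_subset_left h7
  · rw [← hwp]
    exact Finset.sum_subset Finset.inter_subset_left fun v hv hv' => by rw [h7 v hv hv', zero_smul]

open Classical in
/-- The simplicial complex that consists of the cones over the triangles of a fan and their
faces. -/
def mesh (h : IsPolytopalFan T) : Geometry.SimplicialComplex ℝ E3 where
  faces := generatedFaces {s | ∃ t ∈ T, s = insert 0 t}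
  isRelLowerSet_faces := by
    rintro s ⟨hs, t, ht, hst⟩
    exact ⟨hs, fun r hrs hr => ⟨hr, t, ht, hrs.trans hst⟩⟩
  indep := by
    rintro s ⟨hs, _, ⟨t, ht, rfl⟩, hst⟩
    exact (h.affineIndependent_insert ht).mono (by exact_mod_cast hst)
  inter_subset_convexHull := by
    rintro s s' ⟨hs, _, ⟨t, ht, rfl⟩, hst⟩ ⟨hs', _, ⟨t', ht', rfl⟩, hst'⟩
    exact h.convexHull_inter_subset ht ht' hst hst'

theorem finite_generatedFaces {α : Type*} {F : Set (Finset α)} (hF : F.Finite) :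
    (generatedFaces F).Finite := by
  refine (hF.biUnion fun t _ => t.powerset.finite_toSet).subset ?_
  rintro s ⟨_, t, ht, hst⟩
  exact Set.mem_biUnion ht (by simpa using hst)

theorem isTetrahedralMesh_mesh (h : IsPolytopalFan T) : IsTetrahedralMesh h.mesh := by
  classical
  constructor
  · refine finite_generatedFaces ((h.finite.image fun t => insert 0 t).subset ?_)
    rintro _ ⟨t, ht, rfl⟩
    exact ⟨t, ht, rfl⟩
  · rintro s ⟨hs, _, ⟨t, ht, rfl⟩, hst⟩
    refine ⟨insert 0 t, ⟨Finset.insert_nonempty _ _, _, ⟨t, ht, rfl⟩, subset_rfl⟩, hst, ?_⟩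
    rw [Finset.card_insert_of_notMem (h.zero_notMem ht), h.card_eq t ht]

theorem zero_mem_vertices_mesh (h : IsPolytopalFan T) : 0 ∈ h.mesh.vertices := by
  classical
  obtain ⟨t, ht⟩ := h.nonempty
  exact ⟨Finset.singleton_nonempty _, _, ⟨t, ht, rfl⟩, by simp⟩

theorem faces_link_mesh (h : IsPolytopalFan T) :
    (link h.mesh.toPreAbstractSimplicialComplex 0).faces = generatedFaces T := by
  classical
  ext s
  constructor
  · rintro ⟨⟨hs, _, ⟨t, ht, rfl⟩, hst⟩, h0, -⟩
    exact ⟨hs, t, ht, (Finset.subset_insert_iff_of_notMem h0).1 hst⟩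
  · rintro ⟨hs, t, ht, hst⟩
    refine ⟨⟨hs, _, ⟨t, ht, rfl⟩, hst.trans (Finset.subset_insert _ _)⟩,
      fun h0 => h.zero_notMem ht (hst h0), insert 0 t,
      ⟨Finset.insert_nonempty _ _, _, ⟨t, ht, rfl⟩, subset_rfl⟩, Finset.mem_insert_self _ _,
      hst.trans (Finset.subset_insert _ _)⟩

/-- The realization is a finite union of closed subsets of the cube `[0, 1] ^ α`, which is compact
by Tychonoff even for infinite `α`. -/
theorem isCompact_realization {α : Type*} {K : PreAbstractSimplicialComplex α}
    (hK : K.faces.Finite) : IsCompact (realization K) := by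
  classical
  have h1 : realization K = ⋃ s ∈ K.faces,
      {x : α → ℝ | (∀ v, 0 ≤ x v) ∧ (∀ v, v ∉ s → x v = 0) ∧ ∑ v ∈ s, x v = 1} := by
    ext x
    simp only [realization, Set.mem_ofPred_eq, Set.mem_iUnion, exists_prop]
    tauto
  rw [h1]
  refine hK.isCompact_biUnion fun s _ => ?_
  refine (isCompact_univ_pi (X := fun _ : α => ℝ) fun _ =>
    (isCompact_Icc : IsCompact (Set.Icc (0 : ℝ) 1))).of_isClosed_subset ?_ ?_
  · simp only [Set.ofPred_and, Set.ofPred_forall]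
    refine (isClosed_iInter fun v => isClosed_le continuous_const (continuous_apply v)).inter
      ((isClosed_iInter fun v => isClosed_iInter fun _ =>
        isClosed_eq (continuous_apply v) continuous_const).inter
        (isClosed_eq (continuous_finsetSum _ fun v _ => continuous_apply v) continuous_const))
  · rintro x ⟨h0, hs, h1⟩ v -
    refine ⟨h0 v, ?_⟩
    by_cases hv : v ∈ s
    · rw [← h1]; exact Finset.single_le_sum (fun w _ => h0 w) hv
    · rw [hs v hv]; exact zero_le_one

/-- Radial projection is the homeomorphism: uniqueness of conic combinations gives injectivity,
covering gives surjectivity, and the source is compact. -/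
theorem isSphereTriangulation_link_mesh (h : IsPolytopalFan T) :
    IsSphereTriangulation (link h.mesh.toPreAbstractSimplicialComplex 0) := by
  classical
  set K := link h.mesh.toPreAbstractSimplicialComplex 0 with hK
  have hfin : K.faces.Finite := by
    rw [hK, h.faces_link_mesh]; exact finite_generatedFaces h.finite
  refine ⟨hfin, ?_⟩
  obtain ⟨V, hV⟩ : ∃ V : Finset E3, ∀ t ∈ T, t ⊆ V :=
    ⟨h.finite.toFinset.sup id, fun t ht =>
      Finset.le_sup (f := id) (h.finite.mem_toFinset.2 ht)⟩
  have hmem : ∀ x : E3 → ℝ, x ∈ realization K ↔ (∀ v, 0 ≤ x v) ∧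
      ∃ t ∈ T, (∀ v ∉ t, x v = 0) ∧ ∑ v ∈ t, x v = 1 := by
    intro x
    refine and_congr_right fun _ => ?_
    rw [hK, h.faces_link_mesh]
    constructor
    · rintro ⟨s, ⟨hs, t, ht, hst⟩, h1, h2⟩
      refine ⟨t, ht, fun v hv => h1 v fun h => hv (hst h), ?_⟩
      rw [← h2, Finset.sum_subset hst fun v _ hv => h1 v hv]
    · rintro ⟨t, ht, h1, h2⟩
      exact ⟨t, ⟨Finset.card_pos.1 (by rw [h.card_eq t ht]; norm_num), t, ht, subset_rfl⟩, h1, h2⟩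
  let Φ : (E3 → ℝ) → E3 := fun x => ∑ v ∈ V, x v • v
  have hΦc : Continuous Φ :=
    continuous_finsetSum _ fun v _ => (continuous_apply v).smul continuous_const
  have hΦ : ∀ t ∈ T, ∀ x : E3 → ℝ, (∀ v ∉ t, x v = 0) → Φ x = ∑ v ∈ t, x v • v :=
    fun t ht x hx => (Finset.sum_subset (hV t ht) fun v _ hv => by rw [hx v hv, zero_smul]).symm
  have hΦ0 : ∀ x ∈ realization K, Φ x ≠ 0 := by
    intro x hx h0
    obtain ⟨hx0, t, ht, hxt, hx1⟩ := (hmem x).1 hx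
    rw [hΦ t ht x hxt] at h0
    have := h.eq_of_sum_smul_eq ht ht hx0 (y := 0) (fun _ => le_rfl) hxt (fun _ _ => rfl)
      (by simp [h0])
    rw [this] at hx1
    simp at hx1
  let f : realization K → Metric.sphere (0 : E3) 1 := fun x =>
    ⟨‖Φ x‖⁻¹ • Φ x, by
      rw [mem_sphere_zero_iff_norm, norm_smul, norm_inv, norm_norm,
        inv_mul_cancel₀ (norm_ne_zero_iff.2 (hΦ0 x x.2))]⟩
  have hfc : Continuous f := by
    have h1 : Continuous fun x : realization K => Φ x := hΦc.comp continuous_subtype_val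
    exact ((h1.norm.inv₀ fun x => norm_ne_zero_iff.2 (hΦ0 x x.2)).smul h1).subtype_mk _
  have hinj : Function.Injective f := by
    intro x y hxy
    obtain ⟨hx0, t, ht, hxt, hx1⟩ := (hmem x).1 x.2
    obtain ⟨hy0, t', ht', hyt, hy1⟩ := (hmem y).1 y.2
    have h1 : ‖Φ x‖⁻¹ • Φ x = ‖Φ y‖⁻¹ • Φ y := congrArg Subtype.val hxy
    set a := ‖Φ x‖⁻¹ with ha
    set b := ‖Φ y‖⁻¹ with hb
    have ha0 : 0 < a := inv_pos.2 (norm_pos_iff.2 (hΦ0 x x.2))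
    have h2 := h.eq_of_sum_smul_eq ht ht' (x := fun v => a * x.1 v) (y := fun v => b * y.1 v)
      (fun v => mul_nonneg ha0.le (hx0 v))
      (fun v => mul_nonneg (inv_nonneg.2 (norm_nonneg _)) (hy0 v))
      (fun v hv => by rw [hxt v hv, mul_zero]) (fun v hv => by rw [hyt v hv, mul_zero])
      (by
        rw [hΦ t ht x hxt, hΦ t' ht' y hyt] at h1
        simpa only [Finset.smul_sum, smul_smul] using h1)
    have h3 : ∀ (z : E3 → ℝ) (s : Finset E3), s ∈ T → (∀ v ∉ s, z v = 0) →
        ∑ v ∈ s, z v = ∑ v ∈ V, z v := fun z s hs hz =>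
      Finset.sum_subset (hV s hs) fun v _ hv => hz v hv
    -- Barycentric coordinates sum to 1 on both sides, so the scaling factors agree.
    have h4 : a = b := by
      have h5 := congrArg (fun z : E3 → ℝ => ∑ v ∈ V, z v) h2
      simp only [← Finset.mul_sum] at h5
      rwa [← h3 x t ht hxt, ← h3 y t' ht' hyt, hx1, hy1, mul_one, mul_one] at h5
    refine Subtype.ext (funext fun v => ?_)
    have h5 := congrFun h2 v
    simp only [← h4] at h5
    exact mul_left_cancel₀ ha0.ne' h5
  have hsurj : Function.Surjective f := by
    rintro ⟨p, hp⟩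
    rw [mem_sphere_zero_iff_norm] at hp
    obtain ⟨t, ht, x, hx0, hxt, hxp⟩ := h.exists_sum_smul_eq p
    have hc : 0 < ∑ v ∈ t, x v := by
      refine lt_of_le_of_ne (Finset.sum_nonneg fun v _ => hx0 v) fun h0 => ?_
      have h1 := (Finset.sum_eq_zero_iff_of_nonneg fun v _ => hx0 v).1 h0.symm
      have : p = 0 := by
        rw [← hxp]; exact Finset.sum_eq_zero fun v hv => by rw [h1 v hv, zero_smul]
      simp [this] at hp
    set c := ∑ v ∈ t, x v with hcdef
    have hyt : ∀ v ∉ t, c⁻¹ * x v = 0 := fun v hv => by rw [hxt v hv, mul_zero]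
    have hy : (fun v => c⁻¹ * x v) ∈ realization K := by
      refine (hmem _).2 ⟨fun v => mul_nonneg (inv_nonneg.2 hc.le) (hx0 v), t, ht, hyt, ?_⟩
      rw [← Finset.mul_sum, ← hcdef, inv_mul_cancel₀ hc.ne']
    have h1 : Φ (fun v => c⁻¹ * x v) = c⁻¹ • p := by
      rw [hΦ t ht _ hyt, ← hxp, Finset.smul_sum]
      exact Finset.sum_congr rfl fun v _ => (smul_smul _ _ _).symm
    refine ⟨⟨_, hy⟩, Subtype.ext ?_⟩
    change ‖Φ (fun v => c⁻¹ * x v)‖⁻¹ • Φ (fun v => c⁻¹ * x v) = p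
    rw [h1, norm_smul, hp, mul_one, norm_inv, inv_inv, Real.norm_of_nonneg hc.le, smul_smul,
      mul_inv_cancel₀ hc.ne', one_smul]
  have := isCompact_iff_compactSpace.1 (isCompact_realization hfin)
  exact ⟨(isHomeomorph_iff_continuous_bijective.2 ⟨hfc, hinj, hsurj⟩).homeomorph⟩

end IsPolytopalFan

end Fan

/-! ### Circumcenters as positive combinations of the vertices -/

section WellCentering

/-- Some positive convex combination of the points of `s` is equidistant from them. -/
def HasInteriorCenter (s : Finset E3) : Prop :=
  ∃ (w : E3 → ℝ) (r : ℝ), (∀ v ∈ s, 0 < w v) ∧ ∑ v ∈ s, w v = 1 ∧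
    ∀ v ∈ s, dist v (∑ u ∈ s, w u • u) = r

/-- The circumcenter is the only equidistant point in the affine span. Interior points need weights
below 1 too, which follows from a second positive weight since `1 ≤ k`. -/
theorem HasInteriorCenter.circumcenter_mem_interior {s : Finset E3} (h : HasInteriorCenter s)
    {k : ℕ} (hk : 1 ≤ k) (σ : Affine.Simplex ℝ E3 k) (hs : (s : Set E3) = Set.range σ.points) :
    σ.circumcenter ∈ σ.interior := by
  obtain ⟨w, r, hw, hw1, hr⟩ := h
  have h1 : s = Finset.univ.map ⟨σ.points, σ.independent.injective⟩ := by
    rw [← Finset.coe_inj, hs]; simp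
  have hmem : ∀ i, σ.points i ∈ s := fun i => by
    rw [← Finset.mem_coe, hs]; exact Set.mem_range_self i
  have h2 : ∑ i, w (σ.points i) = 1 := by
    rw [h1, Finset.sum_map] at hw1; exact hw1
  have h3 : Finset.univ.affineCombination ℝ σ.points (fun i => w (σ.points i)) =
      ∑ u ∈ s, w u • u := by
    rw [Finset.affineCombination_eq_linear_combination _ _ _ h2, h1, Finset.sum_map]; rfl
  have h4 : ∑ u ∈ s, w u • u = σ.circumcenter := by
    refine σ.eq_circumcenter_of_dist_eq ?_ fun i => hr _ (hmem i)
    rw [← h3]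
    exact affineCombination_mem_affineSpan h2 _
  rw [← h4, ← h3, Affine.Simplex.affineCombination_mem_interior_iff h2]
  refine fun i => ⟨hw _ (hmem i), ?_⟩
  have : Nontrivial (Fin (k + 1)) := Fin.nontrivial_iff_two_le.2 (by omega)
  obtain ⟨j, hj⟩ := exists_ne i
  rw [← h2]
  exact Finset.single_lt_sum hj (Finset.mem_univ i) (Finset.mem_univ j) (hw _ (hmem j))
    fun l _ _ => (hw _ (hmem l)).le

/-- With `c` the combination, `‖v - c‖ ^ 2 = ‖v‖ ^ 2 - 2 * ⟪v, c⟫ + ‖c‖ ^ 2` and the last term does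
not depend on `v`. Equidistance thus becomes a condition on the Gram matrix. -/
theorem hasInteriorCenter_of_inner {s : Finset E3} (w : E3 → ℝ) (r : ℝ) (hw : ∀ v ∈ s, 0 < w v)
    (hw1 : ∑ v ∈ s, w v = 1)
    (hr : ∀ v ∈ s, ‖v‖ ^ 2 - 2 * ∑ u ∈ s, w u * inner ℝ v u = r) : HasInteriorCenter s := by
  refine ⟨w, √(r + ‖∑ u ∈ s, w u • u‖ ^ 2), hw, hw1, fun v hv => ?_⟩
  have h1 : ∑ u ∈ s, w u * inner ℝ v u = inner ℝ v (∑ u ∈ s, w u • u) := by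
    simp only [inner_sum, real_inner_smul_right]
  rw [← hr v hv, h1, ← norm_sub_sq_real, dist_eq_norm, Real.sqrt_sq (norm_nonneg _)]

theorem hasInteriorCenter_pair {a b : E3} (h : a ≠ b) :
    HasInteriorCenter ({a, b} : Finset E3) := by
  classical
  refine hasInteriorCenter_of_inner (fun _ => 1 / 2) (-inner ℝ a b) (fun _ _ => by norm_num) ?_ ?_
  · rw [Finset.sum_pair h]; norm_num
  · intro v hv
    rw [Finset.sum_pair h]
    rcases Finset.mem_insert.1 hv with rfl | hv
    · rw [real_inner_self_eq_norm_sq]; ring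
    · rw [Finset.mem_singleton.1 hv, real_inner_self_eq_norm_sq, real_inner_comm]; ring

open Classical in
theorem hasInteriorCenter_zero_pair {a b : E3} (ha : ‖a‖ = 1) (hb : ‖b‖ = 1)
    (h0 : 0 < inner ℝ a b) (h1 : inner ℝ a b < 1) : HasInteriorCenter {0, a, b} := by
  have hab : a ≠ b := by
    rintro rfl; rw [real_inner_self_eq_norm_sq, ha] at h1; norm_num at h1
  have ha0 : a ≠ 0 := by rintro rfl; simp at ha
  have hb0 : b ≠ 0 := by rintro rfl; simp at hb
  set c := inner ℝ a b with hc
  have hc' : inner ℝ b a = c := real_inner_comm _ _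
  have hs : (0 : E3) ∉ ({a, b} : Finset E3) := by simp [ha0.symm, hb0.symm]
  -- The circumcenter is `(a + b) / (2 * (1 + c))`, and the origin takes the remaining weight. The
  -- constant is 0 because the origin is a vertex.
  refine hasInteriorCenter_of_inner (fun v => if v = 0 then c / (1 + c) else 1 / (2 * (1 + c))) 0
    (fun v _ => ?_) ?_ ?_
  · split_ifs <;> positivity
  · rw [Finset.sum_insert hs, Finset.sum_pair hab, if_pos rfl, if_neg ha0, if_neg hb0]
    field_simp; ring
  · intro v hv
    rw [Finset.sum_insert hs, Finset.sum_pair hab, if_pos rfl, if_neg ha0, if_neg hb0]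
    simp only [Finset.mem_insert, Finset.mem_singleton] at hv
    rcases hv with rfl | rfl | rfl
    · simp
    · rw [real_inner_self_eq_norm_sq, ha, ← hc, inner_zero_right]; field_simp; ring
    · rw [real_inner_self_eq_norm_sq, hb, hc', inner_zero_right]; field_simp; ring

/-- Unit vectors that span an isosceles triangle with apex `a`, where the two inner products
are such that the triangle and its cone from the origin contain their circumcenters. -/
structure IsCenteredTriple (a b c : E3) (p q : ℝ) : Prop where
  norm_a : ‖a‖ = 1
  norm_b : ‖b‖ = 1
  norm_c : ‖c‖ = 1
  inner_ab : inner ℝ a b = p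
  inner_ac : inner ℝ a c = p
  inner_bc : inner ℝ b c = q
  p_pos : 0 < p
  p_lt_one : p < 1
  q_lt_one : q < 1
  two_p_lt : 2 * p < 1 + q
  sq_lt : (1 - 2 * p) ^ 2 < q

namespace IsCenteredTriple

variable {a b c : E3} {p q : ℝ}

theorem inner_ba (h : IsCenteredTriple a b c p q) : inner ℝ b a = p := by
  rw [real_inner_comm, h.inner_ab]

theorem inner_ca (h : IsCenteredTriple a b c p q) : inner ℝ c a = p := by
  rw [real_inner_comm, h.inner_ac]

theorem inner_cb (h : IsCenteredTriple a b c p q) : inner ℝ c b = q := by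
  rw [real_inner_comm, h.inner_bc]

/-- The Gram determinant of `a, b, c` is `(1 - q) * (1 + q - 2 * p ^ 2)`. Positivity holds by `2 * p
^ 2 < 2 * p < 1 + q`. -/
theorem det_pos (h : IsCenteredTriple a b c p q) : 0 < 1 + q - 2 * p ^ 2 := by
  nlinarith [h.p_pos, h.p_lt_one, h.two_p_lt]

theorem q_pos (h : IsCenteredTriple a b c p q) : 0 < q := (sq_nonneg _).trans_lt h.sq_lt

theorem ne_ab (h : IsCenteredTriple a b c p q) : a ≠ b := by
  rintro rfl
  have := h.inner_ab
  rw [real_inner_self_eq_norm_sq, h.norm_a] at this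
  linarith [h.p_lt_one]

theorem ne_ac (h : IsCenteredTriple a b c p q) : a ≠ c := by
  rintro rfl
  have := h.inner_ac
  rw [real_inner_self_eq_norm_sq, h.norm_a] at this
  linarith [h.p_lt_one]

theorem ne_bc (h : IsCenteredTriple a b c p q) : b ≠ c := by
  rintro rfl
  have := h.inner_bc
  rw [real_inner_self_eq_norm_sq, h.norm_b] at this
  linarith [h.q_lt_one]

open Classical in
theorem sum_eq (h : IsCenteredTriple a b c p q) {M : Type*} [AddCommMonoid M] (f : E3 → M) :
    ∑ v ∈ ({a, b, c} : Finset E3), f v = f a + f b + f c := by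
  rw [Finset.sum_insert (by simp [h.ne_ab, h.ne_ac]), Finset.sum_pair h.ne_bc, add_assoc]

open Classical in
theorem card_eq (h : IsCenteredTriple a b c p q) : ({a, b, c} : Finset E3).card = 3 :=
  Finset.card_eq_three.2 ⟨a, b, c, h.ne_ab, h.ne_ac, h.ne_bc, rfl⟩

open Classical in
theorem norm_eq (h : IsCenteredTriple a b c p q) {v : E3} (hv : v ∈ ({a, b, c} : Finset E3)) :
    ‖v‖ = 1 := by
  simp only [Finset.mem_insert, Finset.mem_singleton] at hv
  rcases hv with rfl | rfl | rfl
  exacts [h.norm_a, h.norm_b, h.norm_c]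

open Classical in
theorem zero_notMem (h : IsCenteredTriple a b c p q) : (0 : E3) ∉ ({a, b, c} : Finset E3) :=
  fun h0 => by simpa using h.norm_eq h0

-- Pairing a relation with `a`, `b`, `c` gives a linear system with the Gram matrix, which is
-- invertible by `det_pos` and `q < 1`.
open Classical in
theorem linearIndepOn (h : IsCenteredTriple a b c p q) :
    LinearIndepOn ℝ id (({a, b, c} : Finset E3) : Set E3) := by
  rw [linearIndepOn_finset_iff]
  intro f hf
  rw [h.sum_eq] at hf
  simp only [id] at hf
  have key : ∀ v : E3, f a * inner ℝ v a + f b * inner ℝ v b + f c * inner ℝ v c = 0 := fun v => by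
    have := congrArg (fun x => inner ℝ v x) hf
    simpa only [inner_add_right, real_inner_smul_right, inner_zero_right] using this
  have h1 := key a
  have h2 := key b
  have h3 := key c
  rw [real_inner_self_eq_norm_sq, h.norm_a, h.inner_ab, h.inner_ac] at h1
  rw [real_inner_self_eq_norm_sq, h.norm_b, h.inner_ba, h.inner_bc] at h2
  rw [real_inner_self_eq_norm_sq, h.norm_c, h.inner_ca, h.inner_cb] at h3
  have h4 : f b = f c := by
    have : (1 - q) * (f b - f c) = 0 := by linear_combination h2 - h3
    have h5 := (mul_eq_zero.1 this).resolve_left (by linarith [h.q_lt_one])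
    linarith
  have h5 : f c = 0 := by
    have : (1 + q - 2 * p ^ 2) * f c = 0 := by
      rw [h4] at h1 h2
      linear_combination h2 - p * h1
    exact (mul_eq_zero.1 this).resolve_left h.det_pos.ne'
  have h6 : f a = 0 := by
    rw [h4, h5] at h1; linarith
  intro v hv
  simp only [Finset.mem_insert, Finset.mem_singleton] at hv
  rcases hv with rfl | rfl | rfl
  exacts [h6, h4.trans h5, h5]

open Classical in
theorem hasInteriorCenter (h : IsCenteredTriple a b c p q) :
    HasInteriorCenter ({a, b, c} : Finset E3) := by
  have hp := h.p_lt_one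
  have h2p := h.two_p_lt
  have hD : 0 < 3 + q - 4 * p := by linarith
  have hD' := hD.ne'
  -- These are the barycentric coordinates of the circumcenter of an isosceles triangle. The apex
  -- weight is positive exactly when the apex angle is acute, as `1 + q - 2 * p` is the inner
  -- product of `b - a` and `c - a`.
  refine hasInteriorCenter_of_inner
    (fun v => if v = a then (1 + q - 2 * p) / (3 + q - 4 * p) else (1 - p) / (3 + q - 4 * p))
    (1 - 2 * (1 + q - 2 * p ^ 2) / (3 + q - 4 * p)) (fun v _ => ?_) ?_ ?_
  · split_ifs
    · exact div_pos (by linarith) hD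
    · exact div_pos (by linarith) hD
  · rw [h.sum_eq, if_pos rfl, if_neg h.ne_ab.symm, if_neg h.ne_ac.symm, ← add_div, ← add_div,
      div_eq_one_iff_eq hD.ne']
    ring
  · intro v hv
    rw [h.sum_eq, if_pos rfl, if_neg h.ne_ab.symm, if_neg h.ne_ac.symm, h.norm_eq hv]
    simp only [Finset.mem_insert, Finset.mem_singleton] at hv
    rcases hv with rfl | rfl | rfl
    · rw [real_inner_self_eq_norm_sq, h.norm_a, h.inner_ab, h.inner_ac]; field_simp; ring
    · rw [real_inner_self_eq_norm_sq, h.norm_b, h.inner_ba, h.inner_bc]; field_simp; ring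
    · rw [real_inner_self_eq_norm_sq, h.norm_c, h.inner_ca, h.inner_cb]; field_simp; ring

open Classical in
theorem hasInteriorCenter_insert_zero (h : IsCenteredTriple a b c p q) :
    HasInteriorCenter (insert 0 ({a, b, c} : Finset E3)) := by
  have hp := h.p_lt_one
  have h2p := h.two_p_lt
  have hD := h.det_pos
  have hsq := h.sq_lt
  have ha0 : a ≠ 0 := by rintro rfl; simpa using h.norm_a
  have hb0 : b ≠ 0 := by rintro rfl; simpa using h.norm_b
  have hc0 : c ≠ 0 := by rintro rfl; simpa using h.norm_c
  -- The weights of `a, b, c` solve `⟪v, center⟫ = 1 / 2` for each of these `v`. The origin takes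
  -- the rest, which is positive exactly by `sq_lt`.
  refine hasInteriorCenter_of_inner
    (fun v => if v = 0 then (q - (1 - 2 * p) ^ 2) / (2 * (1 + q - 2 * p ^ 2)) else
      if v = a then (1 + q - 2 * p) / (2 * (1 + q - 2 * p ^ 2))
      else (1 - p) / (2 * (1 + q - 2 * p ^ 2))) 0 (fun v _ => ?_) ?_ ?_
  · split_ifs
    · exact div_pos (by linarith) (by linarith)
    · exact div_pos (by linarith) (by linarith)
    · exact div_pos (by linarith) (by linarith)
  · rw [Finset.sum_insert h.zero_notMem, h.sum_eq]
    simp only [if_true, if_neg ha0, if_neg hb0, if_neg hc0, if_neg h.ne_ab.symm,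
      if_neg h.ne_ac.symm]
    field_simp; ring
  · intro v hv
    rw [Finset.sum_insert h.zero_notMem, h.sum_eq]
    simp only [if_true, if_neg ha0, if_neg hb0, if_neg hc0, if_neg h.ne_ab.symm,
      if_neg h.ne_ac.symm, inner_zero_right, mul_zero, zero_add]
    simp only [Finset.mem_insert, Finset.mem_singleton] at hv
    rcases hv with rfl | rfl | rfl | rfl
    · simp
    · rw [real_inner_self_eq_norm_sq, h.norm_a, h.inner_ab, h.inner_ac]; field_simp; ring
    · rw [real_inner_self_eq_norm_sq, h.norm_b, h.inner_ba, h.inner_bc]; field_simp; ring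
    · rw [real_inner_self_eq_norm_sq, h.norm_c, h.inner_ca, h.inner_cb]; field_simp; ring

open Classical in
theorem inner_mem_Ioo (h : IsCenteredTriple a b c p q) {u v : E3}
    (hu : u ∈ ({a, b, c} : Finset E3)) (hv : v ∈ ({a, b, c} : Finset E3)) (huv : u ≠ v) :
    0 < inner ℝ u v ∧ inner ℝ u v < 1 := by
  have hp := And.intro h.p_pos h.p_lt_one
  have hq := And.intro h.q_pos h.q_lt_one
  simp only [Finset.mem_insert, Finset.mem_singleton] at hu hv
  rcases hu with rfl | rfl | rfl <;> rcases hv with rfl | rfl | rfl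
  exacts [absurd rfl huv, h.inner_ab ▸ hp, h.inner_ac ▸ hp, h.inner_ba ▸ hp, absurd rfl huv,
    h.inner_bc ▸ hq, h.inner_ca ▸ hp, h.inner_cb ▸ hq, absurd rfl huv]

open Classical in
theorem hasInteriorCenter_of_subset (h : IsCenteredTriple a b c p q) {s : Finset E3}
    (hs : s ⊆ insert 0 {a, b, c}) (h2 : 2 ≤ s.card) : HasInteriorCenter s := by
  have h4 : (insert 0 ({a, b, c} : Finset E3)).card = 4 := by
    rw [Finset.card_insert_of_notMem h.zero_notMem, h.card_eq]
  have hle := Finset.card_le_card hs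
  obtain h5 | h5 | h5 : s.card = 2 ∨ s.card = 3 ∨ s.card = 4 := by omega
  · obtain ⟨u, v, huv, rfl⟩ := Finset.card_eq_two.1 h5
    exact hasInteriorCenter_pair huv
  · by_cases h0 : (0 : E3) ∈ s
    · have h6 : (s.erase 0).card = 2 := by rw [Finset.card_erase_of_mem h0, h5]
      obtain ⟨u, v, huv, h7⟩ := Finset.card_eq_two.1 h6
      have h8 : s = {0, u, v} := by rw [← h7, Finset.insert_erase h0]
      have h9 : ∀ x ∈ s.erase 0, x ∈ ({a, b, c} : Finset E3) := fun x hx =>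
        Finset.mem_of_mem_insert_of_ne (hs (Finset.mem_of_mem_erase hx)) (Finset.ne_of_mem_erase hx)
      have hu := h9 u (by simp [h7])
      have hv := h9 v (by simp [h7])
      obtain ⟨h10, h11⟩ := h.inner_mem_Ioo hu hv huv
      rw [h8]
      exact hasInteriorCenter_zero_pair (h.norm_eq hu) (h.norm_eq hv) h10 h11
    · rw [Finset.eq_of_subset_of_card_le ((Finset.subset_insert_iff_of_notMem h0).1 hs)
        (by rw [h5, h.card_eq])]
      exact h.hasInteriorCenter
  · rw [Finset.eq_of_subset_of_card_le hs (by rw [h5, h4])]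
    exact h.hasInteriorCenter_insert_zero

end IsCenteredTriple

open Classical in
theorem IsPolytopalFan.isCompletelyWellCentered_mesh {T : Set (Finset E3)} (h : IsPolytopalFan T)
    (hT : ∀ t ∈ T, ∃ a b c p q, IsCenteredTriple a b c p q ∧ t = {a, b, c}) :
    IsCompletelyWellCentered h.mesh := by
  rintro k hk - σ ⟨s, ⟨-, _, ⟨t, ht, rfl⟩, hst⟩, hs⟩
  obtain ⟨a, b, c, p, q, habc, rfl⟩ := hT t ht
  refine (habc.hasInteriorCenter_of_subset hst ?_).circumcenter_mem_interior hk σ hs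
  have h1 : s = Finset.univ.map ⟨σ.points, σ.independent.injective⟩ := by
    rw [← Finset.coe_inj, hs]; simp
  rw [h1, Finset.card_map, Finset.card_univ, Fintype.card_fin]
  omega

end WellCentering

/-! ### The antiprism with two caps -/

section Antiprism

/-- The point at angle `j * π / k`, on the upper circle for even `j` and on the lower circle for
odd `j`. -/
noncomputable def ringPoint (k : ℕ) (j : ℤ) : E3 :=
  !₂[0.936 * Real.cos (j * (Real.pi / k)), 0.936 * Real.sin (j * (Real.pi / k)),
    0.352 * (-1) ^ j]

/-- The pole on the side of `ringPoint k j`. -/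
noncomputable def pole (j : ℤ) : E3 := !₂[0, 0, (-1) ^ j]

theorem inner_vec3 (a b c a' b' c' : ℝ) :
    inner ℝ (!₂[a, b, c] : E3) !₂[a', b', c'] = a * a' + b * b' + c * c' := by
  simp [PiLp.inner_apply, Fin.sum_univ_three]; ring

theorem neg_one_zpow_mul_self (j : ℤ) : (-1 : ℝ) ^ j * (-1) ^ j = 1 := by
  rw [← zpow_add₀ (by norm_num), Even.neg_one_zpow ⟨j, rfl⟩]

theorem neg_one_zpow_add_two_mul (j a : ℤ) : (-1 : ℝ) ^ (j + 2 * a) = (-1) ^ j := by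
  rw [zpow_add₀ (by norm_num), Even.neg_one_zpow (even_two_mul a), mul_one]

theorem neg_one_zpow_add_one (j : ℤ) : (-1 : ℝ) ^ (j + 1) = -(-1) ^ j := by
  rw [zpow_add_one₀ (by norm_num)]; ring

theorem sign_cases (i j : ℤ) :
    (∃ a, i = j + 2 * a ∧ (-1 : ℝ) ^ i = (-1) ^ j) ∨
      ∃ a, i = j + 1 + 2 * a ∧ (-1 : ℝ) ^ i = -(-1) ^ j := by
  rcases Int.even_or_odd' (i - j) with ⟨a, h | h⟩
  · obtain rfl : i = j + 2 * a := by omega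
    exact Or.inl ⟨a, rfl, neg_one_zpow_add_two_mul _ _⟩
  · obtain rfl : i = j + 1 + 2 * a := by omega
    exact Or.inr ⟨a, rfl, by rw [neg_one_zpow_add_two_mul, neg_one_zpow_add_one]⟩

theorem inner_ringPoint (k : ℕ) (i j : ℤ) : inner ℝ (ringPoint k i) (ringPoint k j) =
    0.876096 * Real.cos ((i - j) * (Real.pi / k)) + 0.123904 * ((-1) ^ i * (-1) ^ j) := by
  rw [ringPoint, ringPoint, inner_vec3, sub_mul, Real.cos_sub]; ring

theorem inner_pole_ringPoint (k : ℕ) (i j : ℤ) :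
    inner ℝ (pole i) (ringPoint k j) = 0.352 * ((-1) ^ i * (-1) ^ j) := by
  rw [pole, ringPoint, inner_vec3]; ring

theorem norm_ringPoint (k : ℕ) (j : ℤ) : ‖ringPoint k j‖ = 1 := by
  have h : ‖ringPoint k j‖ ^ 2 = 1 := by
    rw [← real_inner_self_eq_norm_sq, inner_ringPoint, neg_one_zpow_mul_self, sub_self, zero_mul,
      Real.cos_zero]
    norm_num
  exact (pow_eq_one_iff_of_nonneg (norm_nonneg _) two_ne_zero).1 h

theorem norm_pole (j : ℤ) : ‖pole j‖ = 1 := by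
  have h : ‖pole j‖ ^ 2 = 1 := by
    rw [← real_inner_self_eq_norm_sq, pole, inner_vec3, neg_one_zpow_mul_self]
    norm_num
  exact (pow_eq_one_iff_of_nonneg (norm_nonneg _) two_ne_zero).1 h

theorem pole_add_two_mul (j a : ℤ) : pole (j + 2 * a) = pole j := by
  rw [pole, neg_one_zpow_add_two_mul, pole]

variable {k : ℕ}

theorem ringPoint_add_mul (hk : k ≠ 0) (j n : ℤ) :
    ringPoint k (j + 2 * k * n) = ringPoint k j := by
  have hk' : (k : ℝ) ≠ 0 := Nat.cast_ne_zero.2 hk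
  have h1 : ((j + 2 * k * n : ℤ) : ℝ) * (Real.pi / k) = j * (Real.pi / k) + n * (2 * Real.pi) := by
    push_cast; field_simp
  rw [ringPoint, h1, Real.cos_add_int_mul_two_pi, Real.sin_add_int_mul_two_pi, mul_assoc,
    neg_one_zpow_add_two_mul, ringPoint]

theorem pi_div_mem (hk : 4 ≤ k) : 0 < Real.pi / k ∧ Real.pi / k ≤ Real.pi / 4 := by
  have hk' : (4 : ℝ) ≤ k := by exact_mod_cast hk
  exact ⟨div_pos Real.pi_pos (by linarith),
    div_le_div_of_nonneg_left Real.pi_pos.le (by norm_num) hk'⟩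

theorem cos_pi_div_bounds (hk : 4 ≤ k) :
    0.7 < Real.cos (Real.pi / k) ∧ 1 / 2 ≤ Real.cos (Real.pi / k) ^ 2 ∧
      Real.cos (Real.pi / k) < 1 := by
  obtain ⟨h0, h1⟩ := pi_div_mem hk
  have h2 : √2 / 2 ≤ Real.cos (Real.pi / k) := by
    rw [← Real.cos_pi_div_four]
    exact Real.cos_le_cos_of_nonneg_of_le_pi h0.le (by linarith [Real.pi_pos]) h1
  have h3 : (0 : ℝ) ≤ √2 := Real.sqrt_nonneg 2
  have h4 : √2 ^ 2 = (2 : ℝ) := Real.sq_sqrt (by norm_num)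
  have h5 : (1.4 : ℝ) < √2 := Real.lt_sqrt_of_sq_lt (by norm_num)
  refine ⟨by linarith, by nlinarith, ?_⟩
  rw [← Real.cos_zero]
  exact Real.cos_lt_cos_of_nonneg_of_le_pi le_rfl (by linarith [Real.pi_pos]) h0

theorem cos_eq_one_cases (hk : 4 ≤ k) (m : ℤ) :
    Real.cos (m * (Real.pi / k)) < 1 ∨ ∃ n : ℤ, m = 2 * k * n := by
  rcases (Real.cos_le_one (m * (Real.pi / k))).lt_or_eq with h | h
  · exact Or.inl h
  · obtain ⟨n, hn⟩ := (Real.cos_eq_one_iff _).1 h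
    have hk' : (k : ℝ) ≠ 0 := by positivity
    refine Or.inr ⟨n, ?_⟩
    have hpi := Real.pi_ne_zero
    field_simp at hn
    have : (m : ℝ) = ((2 * k * n : ℤ) : ℝ) := by push_cast; linarith
    exact_mod_cast this

/-- Among the multiples of `π / k`, only those congruent to `0` or `± π / k` have a cosine that is
at least that of `π / k`. -/
theorem cos_lt_cos_cases (hk : 4 ≤ k) (m : ℤ) :
    Real.cos (m * (Real.pi / k)) < Real.cos (Real.pi / k) ∨
      ∃ n : ℤ, m = 2 * k * n ∨ m = 2 * k * n + 1 ∨ m = 2 * k * n - 1 := by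
  obtain ⟨h0, -⟩ := pi_div_mem hk
  have hk' : (0 : ℝ) < k := by positivity
  have hkp : (k : ℝ) * (Real.pi / k) = Real.pi := by field_simp
  have key : ∀ r : ℤ, 2 ≤ r → r ≤ k → Real.cos (r * (Real.pi / k)) < Real.cos (Real.pi / k) := by
    intro r h2 hr
    have h2' : (2 : ℝ) ≤ r := by exact_mod_cast h2
    have hr' : (r : ℝ) ≤ k := by exact_mod_cast hr
    refine Real.cos_lt_cos_of_nonneg_of_le_pi h0.le ?_ (by nlinarith)
    exact (mul_le_mul_of_nonneg_right hr' h0.le).trans_eq hkp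
  set r := m % (2 * k) with hr
  set n := m / (2 * k) with hn
  have hm : m = r + 2 * k * n := (Int.emod_add_mul_ediv m (2 * k)).symm
  have hr0 : 0 ≤ r := Int.emod_nonneg _ (by omega)
  have hr1 : r < 2 * k := Int.emod_lt_of_pos _ (by omega)
  have hcos : Real.cos (m * (Real.pi / k)) = Real.cos (r * (Real.pi / k)) := by
    have h1 : (m : ℝ) * (Real.pi / k) = r * (Real.pi / k) + n * (2 * Real.pi) := by
      rw [hm]; push_cast; field_simp
    rw [h1, Real.cos_add_int_mul_two_pi]
  by_cases c0 : r = 0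
  · exact Or.inr ⟨n, Or.inl (by omega)⟩
  by_cases c1 : r = 1
  · exact Or.inr ⟨n, Or.inr (Or.inl (by omega))⟩
  by_cases c2 : r = 2 * k - 1
  · exact Or.inr ⟨n + 1, Or.inr (Or.inr (by rw [mul_add]; omega))⟩
  left
  rw [hcos]
  by_cases c3 : r ≤ k
  · exact key r (by omega) c3
  -- Reflecting `r` to `2 * k - r` moves the angle to `[0, π]`, where cosine decreases.
  · have h1 : (r : ℝ) * (Real.pi / k) = 2 * Real.pi - ((2 * k - r : ℤ) : ℝ) * (Real.pi / k) := by
      push_cast; rw [sub_mul, mul_assoc, hkp]; ring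
    rw [h1, Real.cos_two_pi_sub]
    exact key _ (by omega) (by omega)

/-- Coincident points have inner product 1, which forces the cosine to be 1 whatever the two signs.
Then `2 * k` divides `i - j`. -/
theorem ringPoint_ne (hk : 4 ≤ k) {i j : ℤ} (hij : i < j) (hj : j < i + 2 * k) :
    ringPoint k i ≠ ringPoint k j := by
  intro h
  have h1 := inner_ringPoint k i j
  rw [← h, real_inner_self_eq_norm_sq, norm_ringPoint] at h1
  have h2 := cos_eq_one_cases hk (i - j)
  push_cast at h2
  have h3 := Real.cos_le_one ((i - j) * (Real.pi / k))
  have h4 : Real.cos ((i - j) * (Real.pi / k)) = 1 := by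
    have h5 := neg_one_zpow_mul_self j
    rcases sign_cases i j with ⟨a, -, h6⟩ | ⟨a, -, h6⟩
    · rw [h6, h5] at h1; linarith
    · rw [h6, neg_mul, h5] at h1; linarith
  obtain ⟨n, hn⟩ := h2.resolve_left h4.not_lt
  have h5 : n < 0 := by
    by_contra! h5
    have : 0 ≤ 2 * (k : ℤ) * n := by positivity
    omega
  have h6 : 2 * (k : ℤ) * n ≤ 2 * k * (-1) := mul_le_mul_of_nonneg_left (by omega) (by omega)
  omega

theorem pole_ne_ringPoint (k : ℕ) (i j : ℤ) : pole i ≠ ringPoint k j := by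
  intro h
  have h1 := inner_pole_ringPoint k i j
  rw [← h, real_inner_self_eq_norm_sq, norm_pole] at h1
  have h5 := neg_one_zpow_mul_self j
  rcases sign_cases i j with ⟨a, -, h6⟩ | ⟨a, -, h6⟩
  · rw [h6, h5] at h1; norm_num at h1
  · rw [h6, neg_mul, h5] at h1; norm_num at h1

theorem cos_two_mul_pi_div (k : ℕ) (j : ℤ) :
    Real.cos (((j : ℤ) - ((j + 2 : ℤ) : ℝ)) * (Real.pi / k)) =
      2 * Real.cos (Real.pi / k) ^ 2 - 1 := by
  rw [← Real.cos_two_mul, ← Real.cos_neg]; congr 1; push_cast; ring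

theorem isCenteredTriple_cap (hk : 4 ≤ k) (j : ℤ) :
    IsCenteredTriple (pole j) (ringPoint k j) (ringPoint k (j + 2)) 0.352
      (1.752192 * Real.cos (Real.pi / k) ^ 2 - 0.752192) := by
  obtain ⟨h1, h2, h3⟩ := cos_pi_div_bounds hk
  have h4 : (-1 : ℝ) ^ (j + 2) = (-1) ^ j := neg_one_zpow_add_two_mul j 1
  have h5 := neg_one_zpow_mul_self j
  -- From `1 / 2 ≤ s ^ 2` follows `0.123904 ≤ q`, while `(1 - 2 * 0.352) ^ 2 = 0.087616`.
  refine ⟨norm_pole _, norm_ringPoint _ _, norm_ringPoint _ _, ?_, ?_, ?_, by norm_num,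
    by norm_num, by nlinarith, by nlinarith, by nlinarith⟩
  · rw [inner_pole_ringPoint, h5, mul_one]
  · rw [inner_pole_ringPoint, h4, h5, mul_one]
  · rw [inner_ringPoint, h4, h5, cos_two_mul_pi_div]; ring

theorem isCenteredTriple_band (hk : 4 ≤ k) (j : ℤ) :
    IsCenteredTriple (ringPoint k (j + 1)) (ringPoint k j) (ringPoint k (j + 2))
      (0.876096 * Real.cos (Real.pi / k) - 0.123904)
      (1.752192 * Real.cos (Real.pi / k) ^ 2 - 0.752192) := by
  obtain ⟨h1, h2, h3⟩ := cos_pi_div_bounds hk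
  have h4 : (-1 : ℝ) ^ (j + 2) = (-1) ^ j := neg_one_zpow_add_two_mul j 1
  have h5 := neg_one_zpow_mul_self j
  have h6 := neg_one_zpow_add_one j
  -- The hint completes the square: `1 + q - 2 * p = 1.752192 * (s - 1 / 2) ^ 2 + 0.057568`. For the
  -- last inequality, `(1 - 2 * p) ^ 2 - q` is a convex quadratic in `s` that is negative at `0.7`
  -- and at `1`.
  refine ⟨norm_ringPoint _ _, norm_ringPoint _ _, norm_ringPoint _ _, ?_, ?_, ?_, by linarith,
    by linarith, by nlinarith, by nlinarith [sq_nonneg (Real.cos (Real.pi / k) - 1 / 2)],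
    by nlinarith⟩
  · rw [inner_ringPoint, h6, neg_mul, h5]; push_cast
    rw [show ((j : ℝ) + 1 - j) * (Real.pi / k) = Real.pi / k by ring]; ring
  · rw [inner_ringPoint, h6, h4, neg_mul, h5]; push_cast
    rw [show ((j : ℝ) + 1 - (j + 2)) * (Real.pi / k) = -(Real.pi / k) by ring, Real.cos_neg]; ring
  · rw [inner_ringPoint, h4, h5, cos_two_mul_pi_div]; ring

open Classical in
/-- The triangle at a pole. -/
noncomputable def capTriangle (k : ℕ) (j : ℤ) : Finset E3 :=
  {pole j, ringPoint k j, ringPoint k (j + 2)}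

open Classical in
/-- The triangle between the two circles. -/
noncomputable def bandTriangle (k : ℕ) (j : ℤ) : Finset E3 :=
  {ringPoint k (j + 1), ringPoint k j, ringPoint k (j + 2)}

theorem mem_capTriangle {j : ℤ} {v : E3} :
    v ∈ capTriangle k j ↔ v = pole j ∨ v = ringPoint k j ∨ v = ringPoint k (j + 2) := by
  simp [capTriangle]

theorem mem_bandTriangle {j : ℤ} {v : E3} :
    v ∈ bandTriangle k j ↔
      v = ringPoint k (j + 1) ∨ v = ringPoint k j ∨ v = ringPoint k (j + 2) := by
  simp [bandTriangle]

theorem capTriangle_add_mul (hk : k ≠ 0) (j n : ℤ) :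
    capTriangle k (j + 2 * k * n) = capTriangle k j := by
  rw [capTriangle, mul_assoc, pole_add_two_mul, ← mul_assoc, ringPoint_add_mul hk, add_right_comm,
    ringPoint_add_mul hk, capTriangle]

theorem bandTriangle_add_mul (hk : k ≠ 0) (j n : ℤ) :
    bandTriangle k (j + 2 * k * n) = bandTriangle k j := by
  rw [bandTriangle, ringPoint_add_mul hk, add_right_comm, ringPoint_add_mul hk, add_right_comm,
    ringPoint_add_mul hk, bandTriangle]

theorem upper_eq (k i : ℕ) : upper k i = ringPoint k (2 * i) := by
  rw [upper, ringPoint, Even.neg_one_zpow (even_two_mul _)]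
  push_cast
  rw [mul_div_assoc, mul_one]

theorem lower_eq (k i : ℕ) : lower k i = ringPoint k (2 * i + 1) := by
  rw [lower, ringPoint, Odd.neg_one_zpow (odd_two_mul_add_one _)]
  push_cast
  rw [mul_div_assoc, mul_neg, mul_one]

theorem north_eq (i : ℤ) : north = pole (2 * i) := by
  rw [north, pole, Even.neg_one_zpow (even_two_mul _)]

theorem south_eq (i : ℤ) : south = pole (2 * i + 1) := by
  rw [south, pole, Odd.neg_one_zpow (odd_two_mul_add_one _)]

theorem exists_emod_eq (hk : k ≠ 0) (j : ℤ) :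
    ∃ (i : ℕ) (n : ℤ), i < 2 * k ∧ j = i + 2 * k * n := by
  have h0 : 0 ≤ j % (2 * k) := Int.emod_nonneg _ (by omega)
  have h1 : j % (2 * k) < 2 * k := Int.emod_lt_of_pos _ (by omega)
  refine ⟨(j % (2 * k)).toNat, j / (2 * k), by omega, ?_⟩
  rw [Int.toNat_of_nonneg h0, Int.emod_add_mul_ediv]

/-- Rotation by `π / k` followed by reflection in the equator shifts the index by one, so parity
merges the four families into two. Periodicity modulo `2 * k` allows integer indices. -/
theorem mem_triangles_iff (hk : k ≠ 0) {t : Finset E3} :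
    t ∈ triangles k ↔ ∃ j : ℤ, t = capTriangle k j ∨ t = bandTriangle k j := by
  classical
  have e1 : ∀ i : ℕ, ({north, upper k i, upper k (i + 1)} : Finset E3) =
      capTriangle k (2 * i) := fun i => by
    rw [capTriangle, upper_eq, upper_eq, north_eq i]; push_cast; rw [mul_add, mul_one]
  have e2 : ∀ i : ℕ, ({south, lower k i, lower k (i + 1)} : Finset E3) =
      capTriangle k (2 * i + 1) := fun i => by
    rw [capTriangle, lower_eq, lower_eq, south_eq i]; push_cast
    rw [mul_add, mul_one, add_right_comm]
  have e3 : ∀ i : ℕ, ({upper k i, upper k (i + 1), lower k i} : Finset E3) =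
      bandTriangle k (2 * i) := fun i => by
    ext v
    rw [mem_bandTriangle, upper_eq, upper_eq, lower_eq]; push_cast; rw [mul_add, mul_one]
    simp only [Finset.mem_insert, Finset.mem_singleton]
    tauto
  have e4 : ∀ i : ℕ, ({lower k i, lower k (i + 1), upper k (i + 1)} : Finset E3) =
      bandTriangle k (2 * i + 1) := fun i => by
    ext v
    rw [mem_bandTriangle, upper_eq, lower_eq, lower_eq]; push_cast
    rw [mul_add, mul_one, add_right_comm, add_assoc (2 * (i : ℤ)) 1 1, one_add_one_eq_two]
    simp only [Finset.mem_insert, Finset.mem_singleton]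
    tauto
  constructor
  · rintro ⟨i, h | h | h | h⟩
    · exact ⟨2 * i, Or.inl (h.trans (by convert e1 i))⟩
    · exact ⟨2 * i + 1, Or.inl (h.trans (by convert e2 i))⟩
    · exact ⟨2 * i, Or.inr (h.trans (by convert e3 i))⟩
    · exact ⟨2 * i + 1, Or.inr (h.trans (by convert e4 i))⟩
  · rintro ⟨j, h⟩
    obtain ⟨m, n, -, rfl⟩ := exists_emod_eq hk j
    rw [capTriangle_add_mul hk, bandTriangle_add_mul hk] at h
    obtain ⟨i, rfl | rfl⟩ := Nat.even_or_odd' m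
    · refine ⟨i, ?_⟩
      push_cast at h
      rcases h with h | h
      · exact Or.inl (h.trans (by convert (e1 i).symm))
      · exact Or.inr (Or.inr (Or.inl (h.trans (by convert (e3 i).symm))))
    · refine ⟨i, ?_⟩
      push_cast at h
      rcases h with h | h
      · exact Or.inr (Or.inl (h.trans (by convert (e2 i).symm)))
      · exact Or.inr (Or.inr (Or.inr (h.trans (by convert (e4 i).symm))))

theorem finite_triangles (hk : k ≠ 0) : (triangles k).Finite := by
  refine (((Set.finite_Iio (2 * k)).image fun i : ℕ => capTriangle k i).union
    ((Set.finite_Iio (2 * k)).image fun i : ℕ => bandTriangle k i)).subset fun t ht => ?_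
  obtain ⟨j, h⟩ := (mem_triangles_iff hk).1 ht
  obtain ⟨m, n, hm, rfl⟩ := exists_emod_eq hk j
  rw [capTriangle_add_mul hk, bandTriangle_add_mul hk] at h
  rcases h with rfl | rfl
  · exact Or.inl ⟨m, hm, rfl⟩
  · exact Or.inr ⟨m, hm, rfl⟩

/-- The normal vectors of the triangles, up to scaling. -/
noncomputable def normal (k : ℕ) (j : ℤ) (A B : ℝ) : E3 :=
  !₂[A / 0.936 * Real.cos ((j + 1) * (Real.pi / k)), A / 0.936 * Real.sin ((j + 1) * (Real.pi / k)),
    B / 0.352 * (-1) ^ j]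

/-- On the circle of `j` the largest value is at `j` and `j + 2`, on the other circle at `j + 1`,
provided `0 < A`. Each facet type then fixes `A` and `B`. -/
theorem inner_normal_ringPoint (k : ℕ) (i j : ℤ) (A B : ℝ) :
    inner ℝ (normal k j A B) (ringPoint k i) =
      A * Real.cos (((i - (j + 1) : ℤ) : ℝ) * (Real.pi / k)) + B * ((-1) ^ j * (-1) ^ i) := by
  rw [normal, ringPoint, inner_vec3]; push_cast
  rw [sub_mul, Real.cos_sub]; ring

theorem inner_normal_pole (k : ℕ) (i j : ℤ) (A B : ℝ) :
    inner ℝ (normal k j A B) (pole i) = B / 0.352 * ((-1) ^ j * (-1) ^ i) := by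
  rw [normal, pole, inner_vec3]; ring

theorem eq_pole_or_eq_ringPoint (hk : k ≠ 0) {t : Finset E3} (ht : t ∈ triangles k) {v : E3}
    (hv : v ∈ t) : (∃ i, v = pole i) ∨ ∃ i, v = ringPoint k i := by
  obtain ⟨j, rfl | rfl⟩ := (mem_triangles_iff hk).1 ht
  · rcases mem_capTriangle.1 hv with rfl | rfl | rfl
    exacts [Or.inl ⟨_, rfl⟩, Or.inr ⟨_, rfl⟩, Or.inr ⟨_, rfl⟩]
  · rcases mem_bandTriangle.1 hv with rfl | rfl | rfl
    exacts [Or.inr ⟨_, rfl⟩, Or.inr ⟨_, rfl⟩, Or.inr ⟨_, rfl⟩]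

theorem inner_normal_left (k : ℕ) (j : ℤ) (A B : ℝ) :
    inner ℝ (normal k j A B) (ringPoint k j) = A * Real.cos (Real.pi / k) + B := by
  rw [inner_normal_ringPoint, neg_one_zpow_mul_self,
    show j - (j + 1) = -1 by ring, Int.cast_neg, Int.cast_one, neg_one_mul, Real.cos_neg, mul_one]

theorem inner_normal_right (k : ℕ) (j : ℤ) (A B : ℝ) :
    inner ℝ (normal k j A B) (ringPoint k (j + 2)) = A * Real.cos (Real.pi / k) + B := by
  rw [inner_normal_ringPoint, show (-1 : ℝ) ^ (j + 2) = (-1) ^ j from neg_one_zpow_add_two_mul j 1,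
    neg_one_zpow_mul_self, show j + 2 - (j + 1) = 1 by ring, Int.cast_one, one_mul, mul_one]

theorem inner_normal_middle (k : ℕ) (j : ℤ) (A B : ℝ) :
    inner ℝ (normal k j A B) (ringPoint k (j + 1)) = A - B := by
  rw [inner_normal_ringPoint, neg_one_zpow_add_one, mul_neg, neg_one_zpow_mul_self, sub_self,
    Int.cast_zero, zero_mul, Real.cos_zero]
  ring

/-- The vertices where a vector in the direction of `normal` attains its maximum. -/
theorem inner_normal_lt_cases (hk : 4 ≤ k) (i j : ℤ) {A B : ℝ} (hA : 0 < A) :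
    inner ℝ (normal k j A B) (ringPoint k i) < A * Real.cos (Real.pi / k) + B ∨
      ringPoint k i = ringPoint k j ∨ ringPoint k i = ringPoint k (j + 2) ∨
      inner ℝ (normal k j A B) (ringPoint k i) < A - B ∨
      (ringPoint k i = ringPoint k (j + 1) ∧
        inner ℝ (normal k j A B) (ringPoint k i) = A - B) := by
  have hk0 : k ≠ 0 := by omega
  rw [inner_normal_ringPoint]
  rcases sign_cases i j with ⟨a, ha, h⟩ | ⟨a, ha, h⟩
  · rw [h, neg_one_zpow_mul_self]
    rcases cos_lt_cos_cases hk (i - (j + 1)) with h1 | ⟨n, h1 | h1 | h1⟩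
    · left; nlinarith
    -- Excluded by parity: `i - (j + 1)` is odd.
    · rw [mul_assoc] at h1; omega
    · right; right; left
      rw [show i = j + 2 + 2 * k * n by omega, ringPoint_add_mul hk0]
    · right; left
      rw [show i = j + 2 * k * n by omega, ringPoint_add_mul hk0]
  · rw [h, mul_neg, neg_one_zpow_mul_self]
    rcases cos_eq_one_cases hk (i - (j + 1)) with h1 | ⟨n, h1⟩
    · right; right; right; left; nlinarith
    · have h2 : i = j + 1 + 2 * k * n := by omega
      right; right; right; right
      refine ⟨by rw [h2, ringPoint_add_mul hk0], ?_⟩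
      rw [← inner_normal_middle k j A B, ← ringPoint_add_mul hk0 (j + 1) n, ← h2,
        inner_normal_ringPoint, h, mul_neg ((-1 : ℝ) ^ j), neg_one_zpow_mul_self]

/-- `B = 0.352` gives the value 1 at the pole, and `A * s + B = 1` then gives `A`. The other circle
stays below 1 because `0.648 < 1.352 * s`. -/
theorem exists_support_cap (hk : 4 ≤ k) (j : ℤ) : ∃ l : E3 →ₗ[ℝ] ℝ, ∀ t' ∈ triangles k, ∀ v ∈ t',
    (v ∈ capTriangle k j → l v = 1) ∧ (v ∉ capTriangle k j → l v < 1) := by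
  have hk0 : k ≠ 0 := by omega
  obtain ⟨h1, -, h3⟩ := cos_pi_div_bounds hk
  set s := Real.cos (Real.pi / k) with hs
  have hs0 : 0 < s := by linarith
  have hA : 0 < 0.648 / s := by positivity
  have hmax : 0.648 / s * s + 0.352 = 1 := by rw [div_mul_cancel₀ _ hs0.ne']; norm_num
  have hlt : 0.648 / s - 0.352 < 1 := by
    rw [sub_lt_iff_lt_add, div_lt_iff₀ hs0]; linarith
  refine ⟨innerₗ E3 (normal k j (0.648 / s) 0.352), fun t' ht' v hv => ⟨fun h => ?_, fun h => ?_⟩⟩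
  · rw [innerₗ_apply_apply]
    rcases mem_capTriangle.1 h with rfl | rfl | rfl
    · rw [inner_normal_pole, neg_one_zpow_mul_self]; norm_num
    · rw [inner_normal_left, hmax]
    · rw [inner_normal_right, hmax]
  · rw [innerₗ_apply_apply]
    rw [mem_capTriangle, not_or, not_or] at h
    rcases eq_pole_or_eq_ringPoint hk0 ht' hv with ⟨i, rfl⟩ | ⟨i, rfl⟩
    · rw [inner_normal_pole]
      rcases sign_cases i j with ⟨a, ha, h6⟩ | ⟨a, ha, h6⟩
      · exact absurd (by rw [ha, pole_add_two_mul]) h.1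
      · rw [h6, mul_neg, neg_one_zpow_mul_self]; norm_num
    · rcases inner_normal_lt_cases hk i j (B := 0.352) hA with h6 | h6 | h6 | h6 | ⟨-, h6⟩
      · exact h6.trans_eq hmax
      · exact absurd h6 h.2.1
      · exact absurd h6 h.2.2
      · exact h6.trans hlt
      · exact h6.trans_lt hlt

/-- `A` and `B` solve `A * s + B = 1` and `A - B = 1`. The pole stays below 1 again by `0.648 <
1.352 * s`: both bounds express convexity at the edge shared by a cap and a band triangle. -/
theorem exists_support_band (hk : 4 ≤ k) (j : ℤ) : ∃ l : E3 →ₗ[ℝ] ℝ, ∀ t' ∈ triangles k, ∀ v ∈ t',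
    (v ∈ bandTriangle k j → l v = 1) ∧ (v ∉ bandTriangle k j → l v < 1) := by
  have hk0 : k ≠ 0 := by omega
  obtain ⟨h1, -, h3⟩ := cos_pi_div_bounds hk
  set s := Real.cos (Real.pi / k) with hs
  have hs0 : 0 < 1 + s := by linarith
  have hA : 0 < 2 / (1 + s) := by positivity
  have hmax : 2 / (1 + s) * s + (1 - s) / (1 + s) = 1 := by field_simp; ring
  have hmid : 2 / (1 + s) - (1 - s) / (1 + s) = 1 := by field_simp; ring
  have hB0 : 0 ≤ (1 - s) / (1 + s) := div_nonneg (by linarith) hs0.le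
  have hB : (1 - s) / (1 + s) / 0.352 < 1 := by
    rw [div_lt_one (by norm_num), div_lt_iff₀ hs0]; linarith
  refine ⟨innerₗ E3 (normal k j (2 / (1 + s)) ((1 - s) / (1 + s))),
    fun t' ht' v hv => ⟨fun h => ?_, fun h => ?_⟩⟩
  · rw [innerₗ_apply_apply]
    rcases mem_bandTriangle.1 h with rfl | rfl | rfl
    · rw [inner_normal_middle, hmid]
    · rw [inner_normal_left, hmax]
    · rw [inner_normal_right, hmax]
  · rw [innerₗ_apply_apply]
    rw [mem_bandTriangle, not_or, not_or] at h
    rcases eq_pole_or_eq_ringPoint hk0 ht' hv with ⟨i, rfl⟩ | ⟨i, rfl⟩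
    · rw [inner_normal_pole]
      rcases sign_cases i j with ⟨a, ha, h6⟩ | ⟨a, ha, h6⟩
      · rw [h6, neg_one_zpow_mul_self, mul_one]; exact hB
      · rw [h6, mul_neg, neg_one_zpow_mul_self]
        have : 0 ≤ (1 - s) / (1 + s) / 0.352 := div_nonneg hB0 (by norm_num)
        linarith
    · rcases inner_normal_lt_cases hk i j (B := (1 - s) / (1 + s)) hA with
        h6 | h6 | h6 | h6 | ⟨h6, -⟩
      · exact h6.trans_eq hmax
      · exact absurd h6 h.2.1
      · exact absurd h6 h.2.2
      · exact h6.trans_eq hmid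
      · exact absurd h6 h.1

/-- The neighbor opposite the pole is the band triangle of the same index; the other two are caps
around the same pole, at index distance 2. -/
theorem exists_adjacent_cap (hk : 4 ≤ k) (j : ℤ) {v : E3} (hv : v ∈ capTriangle k j) :
    ∃ t' ∈ triangles k, v ∉ t' ∧ ∀ w ∈ capTriangle k j, w ≠ v → w ∈ t' := by
  have hk0 : k ≠ 0 := by omega
  have hp2 : pole (j + 2) = pole j := pole_add_two_mul j 1
  have hp2' : pole (j - 2) = pole j := by simpa using (pole_add_two_mul (j - 2) 1).symm
  rcases mem_capTriangle.1 hv with rfl | rfl | rfl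
  · refine ⟨bandTriangle k j, (mem_triangles_iff hk0).2 ⟨j, Or.inr rfl⟩, ?_, fun w hw hwv => ?_⟩
    · simp [mem_bandTriangle, pole_ne_ringPoint]
    · rw [mem_capTriangle] at hw; rw [mem_bandTriangle]; tauto
  · refine ⟨capTriangle k (j + 2), (mem_triangles_iff hk0).2 ⟨_, Or.inl rfl⟩, ?_,
      fun w hw hwv => ?_⟩
    · rw [mem_capTriangle, not_or, not_or]
      exact ⟨(pole_ne_ringPoint k _ _).symm, ringPoint_ne hk (by omega) (by omega),
        ringPoint_ne hk (by omega) (by omega)⟩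
    · rw [mem_capTriangle] at hw ⊢; rw [hp2]; tauto
  · refine ⟨capTriangle k (j - 2), (mem_triangles_iff hk0).2 ⟨_, Or.inl rfl⟩, ?_,
      fun w hw hwv => ?_⟩
    · rw [mem_capTriangle, not_or, not_or]
      exact ⟨(pole_ne_ringPoint k _ _).symm, (ringPoint_ne hk (by omega) (by omega)).symm,
        (ringPoint_ne hk (by omega) (by omega)).symm⟩
    · rw [mem_capTriangle] at hw ⊢; rw [hp2', sub_add_cancel]; tauto

/-- The neighbor opposite the middle vertex is the cap of the same index; the other two are
consecutive band triangles. -/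
theorem exists_adjacent_band (hk : 4 ≤ k) (j : ℤ) {v : E3} (hv : v ∈ bandTriangle k j) :
    ∃ t' ∈ triangles k, v ∉ t' ∧ ∀ w ∈ bandTriangle k j, w ≠ v → w ∈ t' := by
  have hk0 : k ≠ 0 := by omega
  rcases mem_bandTriangle.1 hv with rfl | rfl | rfl
  · refine ⟨capTriangle k j, (mem_triangles_iff hk0).2 ⟨j, Or.inl rfl⟩, ?_, fun w hw hwv => ?_⟩
    · rw [mem_capTriangle, not_or, not_or]
      exact ⟨(pole_ne_ringPoint k _ _).symm, (ringPoint_ne hk (by omega) (by omega)).symm,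
        ringPoint_ne hk (by omega) (by omega)⟩
    · rw [mem_bandTriangle] at hw; rw [mem_capTriangle]; tauto
  · refine ⟨bandTriangle k (j + 1), (mem_triangles_iff hk0).2 ⟨_, Or.inr rfl⟩, ?_,
      fun w hw hwv => ?_⟩
    · rw [mem_bandTriangle, not_or, not_or]
      exact ⟨ringPoint_ne hk (by omega) (by omega), ringPoint_ne hk (by omega) (by omega),
        ringPoint_ne hk (by omega) (by omega)⟩
    · rw [mem_bandTriangle] at hw ⊢; rw [add_assoc, one_add_one_eq_two]; tauto
  · refine ⟨bandTriangle k (j - 1), (mem_triangles_iff hk0).2 ⟨_, Or.inr rfl⟩, ?_,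
      fun w hw hwv => ?_⟩
    · rw [mem_bandTriangle, not_or, not_or]
      exact ⟨(ringPoint_ne hk (by omega) (by omega)).symm,
        (ringPoint_ne hk (by omega) (by omega)).symm,
        (ringPoint_ne hk (by omega) (by omega)).symm⟩
    · rw [mem_bandTriangle] at hw ⊢
      rw [sub_add_cancel, show j - 1 + 2 = j + 1 by ring]; tauto

open Classical in
theorem exists_isCenteredTriple (hk : 4 ≤ k) {t : Finset E3} (ht : t ∈ triangles k) :
    ∃ a b c p q, IsCenteredTriple a b c p q ∧ t = {a, b, c} := by
  obtain ⟨j, rfl | rfl⟩ := (mem_triangles_iff (by omega)).1 ht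
  · exact ⟨_, _, _, _, _, isCenteredTriple_cap hk j, rfl⟩
  · exact ⟨_, _, _, _, _, isCenteredTriple_band hk j, rfl⟩

theorem isPolytopalFan_triangles (hk : 4 ≤ k) : IsPolytopalFan (triangles k) where
  finite := finite_triangles (by omega)
  nonempty := ⟨_, (mem_triangles_iff (by omega)).2 ⟨0, Or.inl rfl⟩⟩
  card_eq t ht := by
    obtain ⟨a, b, c, p, q, h, rfl⟩ := exists_isCenteredTriple hk ht
    exact h.card_eq
  linearIndepOn t ht := by
    obtain ⟨a, b, c, p, q, h, rfl⟩ := exists_isCenteredTriple hk ht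
    exact h.linearIndepOn
  exists_support t ht := by
    obtain ⟨j, rfl | rfl⟩ := (mem_triangles_iff (by omega)).1 ht
    exacts [exists_support_cap hk j, exists_support_band hk j]
  exists_adjacent t ht v hv := by
    obtain ⟨j, rfl | rfl⟩ := (mem_triangles_iff (by omega)).1 ht
    exacts [exists_adjacent_cap hk j hv, exists_adjacent_band hk j hv]

end Antiprism

/-! ### Invariance under isomorphism -/

section Isomorphism

variable {α β : Type*} {K : PreAbstractSimplicialComplex α} {L : PreAbstractSimplicialComplex β}

theorem mem_vertexSet_of_mem {s : Finset α} (hs : s ∈ K.faces) {v : α} (hv : v ∈ s) :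
    v ∈ vertexSet K :=
  (K.isRelLowerSet_faces hs).2 (Finset.singleton_subset_iff.2 hv) (Finset.singleton_nonempty v)

theorem exists_map_eq_of_mem_faces {s : Finset α} (hs : s ∈ K.faces) :
    ∃ t : Finset (vertexSet K), t.map (Function.Embedding.subtype _) = s := by
  classical
  refine ⟨s.subtype (· ∈ vertexSet K), ?_⟩
  exact Finset.subtype_map_of_mem fun v hv => mem_vertexSet_of_mem hs hv

theorem finite_vertexSet (hK : K.faces.Finite) : (vertexSet K).Finite :=
  hK.preimage Finset.singleton_injective.injOn

theorem Isomorphic.card_vertexSet (h : Isomorphic K L) :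
    Nat.card (vertexSet K) = Nat.card (vertexSet L) := by
  obtain ⟨e, -⟩ := h
  exact Nat.card_congr e

/-- Every finite complex is isomorphic to one with vertices in `ℕ`. -/
theorem exists_isomorphic_nat (hK : K.faces.Finite) :
    ∃ T : PreAbstractSimplicialComplex ℕ, Isomorphic K T := by
  have : Finite (vertexSet K) := finite_vertexSet hK
  obtain ⟨f₀, hf₀⟩ := exists_injective_nat (vertexSet K)
  let f : vertexSet K ↪ ℕ := ⟨f₀, hf₀⟩
  let T : PreAbstractSimplicialComplex ℕ :=
    { faces := {s | ∃ t : Finset (vertexSet K),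
        t.map (Function.Embedding.subtype _) ∈ K.faces ∧ t.map f = s}
      isRelLowerSet_faces := by
        rintro s ⟨t, ht, rfl⟩
        refine ⟨(Finset.map_nonempty.1 (K.isRelLowerSet_faces ht).1).map, fun r hr hr0 => ?_⟩
        obtain ⟨u, hu, rfl⟩ := Finset.subset_map_iff.1 hr
        exact ⟨u, (K.isRelLowerSet_faces ht).2 (Finset.map_subset_map.2 hu)
          (Finset.map_nonempty.1 hr0).map, rfl⟩ }
  have hT : Set.range f = vertexSet T := by
    ext n
    constructor
    · rintro ⟨v, rfl⟩
      exact ⟨{v}, by rw [Finset.map_singleton]; exact v.2, Finset.map_singleton _ _⟩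
    · rintro ⟨t, -, ht⟩
      have : n ∈ t.map f := by rw [ht]; exact Finset.mem_singleton_self n
      obtain ⟨v, -, hv⟩ := Finset.mem_map.1 this
      exact ⟨v, hv⟩
  refine ⟨T, (Equiv.ofInjective f f.injective).trans (Equiv.setCongr hT), fun s => ?_⟩
  have h1 : (s.map ((Equiv.ofInjective f f.injective).trans (Equiv.setCongr hT)).toEmbedding).map
      (Function.Embedding.subtype _) = s.map f := by
    rw [Finset.map_map]; rfl
  rw [h1]
  exact ⟨fun hs => ⟨s, hs, rfl⟩, fun ⟨t, ht, hts⟩ => Finset.map_injective f hts ▸ ht⟩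

open Classical in
/-- Relabelling of barycentric coordinates along a bijection of vertices. -/
noncomputable def relabel {A : Set α} {B : Set β} (e : A ≃ B) (x : α → ℝ) : β → ℝ :=
  fun w => if h : w ∈ B then x (e.symm ⟨w, h⟩) else 0

theorem continuous_relabel {A : Set α} {B : Set β} (e : A ≃ B) : Continuous (relabel e) := by
  refine continuous_pi fun w => ?_
  unfold relabel
  split_ifs
  exacts [continuous_apply _, continuous_const]

theorem relabel_apply {A : Set α} {B : Set β} (e : A ≃ B) (x : α → ℝ) (v : A) :
    relabel e x (e v) = x v := by
  simp [relabel]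

/-- `relabel` puts 0 outside the vertex set, so it can be undone only on functions that vanish
there, as points of the realization do. -/
theorem relabel_symm_relabel {A : Set α} {B : Set β} (e : A ≃ B) {x : α → ℝ}
    (hx : ∀ v ∉ A, x v = 0) : relabel e.symm (relabel e x) = x := by
  funext v
  by_cases hv : v ∈ A
  · have := relabel_apply e.symm (relabel e x) (e ⟨v, hv⟩)
    rwa [Equiv.symm_apply_apply, relabel_apply] at this
  · rw [hx v hv, relabel, dif_neg hv]

theorem eq_zero_of_mem_realization {x : α → ℝ} (hx : x ∈ realization K) :
    ∀ v ∉ vertexSet K, x v = 0 := by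
  obtain ⟨-, s, hs, h1, -⟩ := hx
  exact fun v hv => h1 v fun h => hv (mem_vertexSet_of_mem hs h)

theorem relabel_mem_realization (e : vertexSet K ≃ vertexSet L)
    (he : ∀ s : Finset (vertexSet K), s.map (Function.Embedding.subtype _) ∈ K.faces →
      (s.map e.toEmbedding).map (Function.Embedding.subtype _) ∈ L.faces)
    {x : α → ℝ} (hx : x ∈ realization K) : relabel e x ∈ realization L := by
  obtain ⟨h0, s, hs, h1, h2⟩ := hx
  obtain ⟨t, rfl⟩ := exists_map_eq_of_mem_faces hs
  refine ⟨fun w => ?_, _, he t hs, fun w hw => ?_, ?_⟩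
  · unfold relabel
    split_ifs
    exacts [h0 _, le_rfl]
  · by_cases h : w ∈ vertexSet L
    · obtain ⟨v, hv⟩ := e.surjective ⟨w, h⟩
      have hw' : w = e v := by rw [hv]
      rw [hw', relabel_apply]
      refine h1 v fun hvt => hw ?_
      rw [hw']
      refine Finset.mem_map_of_mem (Function.Embedding.subtype _)
        (Finset.mem_map_of_mem e.toEmbedding ?_)
      simpa using hvt
    · rw [relabel, dif_neg h]
  · rw [Finset.sum_map] at h2
    rw [Finset.sum_map, Finset.sum_map, ← h2]
    exact Finset.sum_congr rfl fun v _ => relabel_apply e x v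

/-- Needed to pass from the link, whose vertices lie in space, to its copy on `ℕ`. Relabelling
coordinates is a homeomorphism of realizations. -/
theorem IsSphereTriangulation.of_isomorphic (h : IsSphereTriangulation K)
    (hKL : Isomorphic K L) : IsSphereTriangulation L := by
  obtain ⟨hfin, ⟨φ⟩⟩ := h
  obtain ⟨e, he⟩ := hKL
  have he' : ∀ s : Finset (vertexSet L), s.map (Function.Embedding.subtype _) ∈ L.faces →
      (s.map e.symm.toEmbedding).map (Function.Embedding.subtype _) ∈ K.faces := by
    intro s hs
    rw [he]
    have h2 : (s.map e.symm.toEmbedding).map e.toEmbedding = s := by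
      ext x; simp
    rwa [h2]
  constructor
  · have h1 : {s : Finset (vertexSet K) |
        s.map (Function.Embedding.subtype _) ∈ K.faces}.Finite :=
      hfin.preimage (Finset.map_injective _).injOn
    refine (h1.image fun s => (s.map e.toEmbedding).map (Function.Embedding.subtype _)).subset ?_
    intro s hs
    obtain ⟨t, rfl⟩ := exists_map_eq_of_mem_faces hs
    refine ⟨_, he' t hs, ?_⟩
    have h2 : (t.map e.symm.toEmbedding).map e.toEmbedding = t := by
      ext x; simp
    dsimp only
    rw [h2]
  · let ψ : realization K ≃ₜ realization L :=
      { toFun := fun x => ⟨relabel e x, relabel_mem_realization e (fun s => (he s).1) x.2⟩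
        invFun := fun y => ⟨relabel e.symm y, relabel_mem_realization e.symm he' y.2⟩
        left_inv := fun x => Subtype.ext
          (relabel_symm_relabel e (eq_zero_of_mem_realization x.2))
        right_inv := fun y => Subtype.ext
          (relabel_symm_relabel e.symm (eq_zero_of_mem_realization y.2))
        continuous_toFun := ((continuous_relabel e).comp continuous_subtype_val).subtype_mk _
        continuous_invFun := ((continuous_relabel e.symm).comp continuous_subtype_val).subtype_mk _ }
    exact ⟨ψ.symm.trans φ⟩

end Isomorphism

/-! ### Infinitely many isomorphism types -/

theorem le_card_vertexSet_link {k : ℕ} (hk : 4 ≤ k) :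
    2 * k ≤ Nat.card (vertexSet
      (link (isPolytopalFan_triangles hk).mesh.toPreAbstractSimplicialComplex 0)) := by
  set K := link (isPolytopalFan_triangles hk).mesh.toPreAbstractSimplicialComplex 0 with hK
  have hface : K.faces = generatedFaces (triangles k) :=
    (isPolytopalFan_triangles hk).faces_link_mesh
  have hmem : ∀ j : ℤ, ringPoint k j ∈ vertexSet K := fun j => by
    change {ringPoint k j} ∈ K.faces
    rw [hface]
    exact ⟨Finset.singleton_nonempty _, capTriangle k j,
      (mem_triangles_iff (by omega)).2 ⟨j, Or.inl rfl⟩,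
      Finset.singleton_subset_iff.2 (mem_capTriangle.2 (Or.inr (Or.inl rfl)))⟩
  have : Finite (vertexSet K) := finite_vertexSet
    (isPolytopalFan_triangles hk).isSphereTriangulation_link_mesh.1
  have hinj : Function.Injective
      fun i : Fin (2 * k) => (⟨ringPoint k (i : ℕ), hmem _⟩ : vertexSet K) := by
    intro i j hij
    have hij' : ringPoint k (i : ℕ) = ringPoint k (j : ℕ) := congrArg Subtype.val hij
    rcases lt_trichotomy i j with h | h | h
    · exact absurd hij' (ringPoint_ne hk (by exact_mod_cast h) (by omega))
    · exact h
    · exact absurd hij'.symm (ringPoint_ne hk (by exact_mod_cast h) (by omega))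
  simpa using Nat.card_le_card_of_injective _ hinj

theorem infinite_classes :
    Set.Infinite {c : Quotient isoSetoid |
      ∃ T : PreAbstractSimplicialComplex ℕ, c = Quotient.mk isoSetoid T ∧
        IsSphereTriangulation T ∧ AppearsAsLink T} := by
  let card : Quotient isoSetoid → ℕ :=
    Quotient.lift (fun K => Nat.card (vertexSet K)) fun _ _ h => Isomorphic.card_vertexSet h
  refine Set.Infinite.of_image card (Set.infinite_of_not_bddAbove ?_)
  rintro ⟨n, hn⟩
  -- For `k = n + 4` the link has at least `2 * (n + 4) > n` vertices, so `n` does not bound the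
  -- vertex counts.
  have hk : 4 ≤ n + 4 := by omega
  have hfan := isPolytopalFan_triangles hk
  obtain ⟨T, hT⟩ := exists_isomorphic_nat hfan.isSphereTriangulation_link_mesh.1
  have h1 : card (Quotient.mk isoSetoid T) ≤ n := hn ⟨_, ⟨T, rfl,
    hfan.isSphereTriangulation_link_mesh.of_isomorphic hT, hfan.mesh,
    hfan.isTetrahedralMesh_mesh,
    hfan.isCompletelyWellCentered_mesh fun _ => exists_isCenteredTriple hk, 0,
    hfan.zero_mem_vertices_mesh, hT.symm⟩, rfl⟩
  have h2 : 2 * (n + 4) ≤ Nat.card (vertexSet T) := by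
    rw [← hT.card_vertexSet]; exact le_card_vertexSet_link hk
  change Nat.card (vertexSet T) ≤ n at h1
  omega

end WellCentered

theorem mainTheorem9 :
    Set.Infinite {c : Quotient WellCentered.isoSetoid |
      ∃ T : PreAbstractSimplicialComplex ℕ, c = Quotient.mk WellCentered.isoSetoid T ∧
        WellCentered.IsSphereTriangulation T ∧ WellCentered.AppearsAsLink T} ∧
    ∀ k : ℕ, 4 ≤ k →
      ∃ M : Geometry.SimplicialComplex ℝ WellCentered.E3,
        M.faces = WellCentered.generatedFaces (WellCentered.tetrahedra k) ∧
        WellCentered.IsTetrahedralMesh M ∧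
        WellCentered.IsCompletelyWellCentered M ∧
        0 ∈ M.vertices ∧
        (WellCentered.link M.toPreAbstractSimplicialComplex 0).faces =
          WellCentered.generatedFaces (WellCentered.triangles k) ∧
        WellCentered.IsSphereTriangulation
          (WellCentered.link M.toPreAbstractSimplicialComplex 0) := by
  refine ⟨WellCentered.infinite_classes, fun k hk => ?_⟩
  have h := WellCentered.isPolytopalFan_triangles hk
  exact ⟨h.mesh, rfl, h.isTetrahedralMesh_mesh,
    h.isCompletelyWellCentered_mesh fun _ => WellCentered.exists_isCenteredTriple hk,
    h.zero_mem_vertices_mesh, h.faces_link_mesh, h.isSphereTriangulation_link_mesh⟩
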